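/- **Conventions.** A *bigraph* $G=(V_1,V_2,E)$ consists of disjoint finite sets $V_1,V_2$ and a set $E\subseteq V_1\times V_2$; put $V(G)=V_1\cup V_2$ and $e(G)=|E|$, and let $\rho$ be the bigraph that consists of a single edge. For $U\subseteq V(G)$, $G|_U$ is the subgraph induced by $U$. Isomorphisms of bigraphs respect the two vertex classes. A *bigraphon* over probability spaces $(X,\mu)$, $(Y,\nu)$ is a bounded measurable function $W:X\times Y\to[0,\infty)$, and $$t(G,W)=\int_{X^{V_1}\times Y^{V_2}}\ \prod_{(v,w)\in E}W(x_v,y_w)\ d(\mu^{V_1}\otimes\nu^{V_2})(x,y).$$ $W$ is *biregular* if $\int_Y W(x_0,y)\,d\nu(y)=t(\rho,W)=\int_X W(x,y_0)\,d\mu(x)$ for almost every $x_0\in X$ and almost every $y_0\in Y$. $G$ is a *Sidorenko bigraph* if $t(G,W)\ge t(\rho,W)^{e(G)}$ for every bigraphon $W$. $G_1$ *weakly dominates* $G_2$ if $$\frac{t(G_1,W)}{t(\rho,W)^{e(G_1)}}\ \ge\ \frac{t(G_2,W)}{t(\rho,W)^{e(G_2)}}$$ for every biregular bigraphon $W$ that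 is non-zero (i.e. not almost everywhere $0$). The *$2$-core* $C_2(G)$ of a connected bigraph $G$ is its largest subgraph in which every vertex has degree at least $2$ (the empty bigraph if $G$ is a tree). For $S\subseteq V(G)$, the *flag* $(G,S)$ is $G$ with the vertices of $S$ labelled; its *$2$-core* $C_2(G,S)$ is the flag $(G',S)$, where $G'$ is the largest subgraph of $G$ that contains $S$ and in which every vertex outside $S$ has degree at least $2$. Isomorphisms of flags preserve the labels. A *reflective tree decomposition* of a connected bigraph $G$ with at least two vertices is a tree $T$ such that 1. $V(T)\subseteq 2^{V(G)}$ and $V(G)=\bigcup_{U\in V(T)}U$; 2. for every $(v,w)\in E(G)$ there is $U\in V(T)$ with $v,w\in U$; 3. $U_1\cap U_2\subseteq U_3$ for all $U_1,U_2\in V(T)$ and every $U_3\in V(T)$ on the path of $T$ from $U_1$ to $U_2$; 4. for every $\{U_1,U_2\}\in E(T)$ the flags $C_2(G|_{U_1},U_1\cap U_2)$ and $C_2(G|_{U_2},U_1\cap U_2)$ are isomorphic, where each vertex of $U_1\cap U_2$ has the same label in both. Then all the bigraphs $C_2(G|_U)$, $U\in V(T)$, are isomorphic; this common bigraph is the *core*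 of the decomposition. **Theorem 3.5.** Let $G$ be a connected bigraph with at least two vertices, and let $T$ be a reflective tree decomposition of $G$ whose core $H$ weakly dominates $G|_{U_1\cap U_2}$ for every $\{U_1,U_2\}\in E(T)$. Then $G$ weakly dominates $H$. In particular, if $H$ is a Sidorenko bigraph, then $G$ is a Sidorenko bigraph. -/

import Mathlib

open MeasureTheory

universe w u₁ u₂ u₃ u₄ u₅

/-- A bigraph with vertex classes the finite types `V₁` and `V₂`; its vertex set is the disjoint
union `V₁ ⊕ V₂`, and its edge set is a subset of `V₁ × V₂`. -/
structure Bigraph (V₁ : Type u₁) (V₂ : Type u₂) where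
  edges : Finset (V₁ × V₂)

namespace Bigraph

variable {V₁ : Type u₁} {V₂ : Type u₂} {V₁' : Type u₃} {V₂' : Type u₄}

/-- The number of edges `e(G)`. -/
def e (G : Bigraph V₁ V₂) : ℕ := G.edges.card

/-- The bigraph `ρ` that consists of a single edge. -/
def rho : Bigraph Unit Unit := ⟨Finset.univ⟩

/-- The ordinary (bipartite) graph on `V₁ ⊕ V₂` that underlies `G`. -/
def graph (G : Bigraph V₁ V₂) : SimpleGraph (V₁ ⊕ V₂) :=
  SimpleGraph.fromRel fun a b => ∃ p ∈ G.edges, a = Sum.inl p.1 ∧ b = Sum.inr p.2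

/-- A bigraph is connected if its underlying graph is. -/
def IsConnected (G : Bigraph V₁ V₂) : Prop := G.graph.Connected

/-- The left vertices that lie in `U`. -/
abbrev Left (U : Set (V₁ ⊕ V₂)) : Type u₁ := {v : V₁ // Sum.inl v ∈ U}

/-- The right vertices that lie in `U`. -/
abbrev Right (U : Set (V₁ ⊕ V₂)) : Type u₂ := {v : V₂ // Sum.inr v ∈ U}

noncomputable instance [Finite V₁] (U : Set (V₁ ⊕ V₂)) : Fintype (Left U) := Fintype.ofFinite _

noncomputable instance [Finite V₂] (U : Set (V₁ ⊕ V₂)) : Fintype (Right U) := Fintype.ofFinite _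

/-- A vertex of `G` that lies in `U`, as a vertex of the subgraph induced by `U`. -/
def toInduced (U : Set (V₁ ⊕ V₂)) : (v : V₁ ⊕ V₂) → v ∈ U → Left U ⊕ Right U
  | Sum.inl v, h => Sum.inl ⟨v, h⟩
  | Sum.inr v, h => Sum.inr ⟨v, h⟩

theorem toInduced_injective (U : Set (V₁ ⊕ V₂)) (a b : V₁ ⊕ V₂) (ha : a ∈ U) (hb : b ∈ U)
    (h : toInduced U a ha = toInduced U b hb) : a = b := by
  cases a <;> cases b <;> simp_all [toInduced]

open Classical in
/-- The subgraph `G|_U` of `G` that is induced by the vertex set `U`. -/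
noncomputable def induce [Finite V₁] [Finite V₂] (G : Bigraph V₁ V₂) (U : Set (V₁ ⊕ V₂)) :
    Bigraph (Left U) (Right U) :=
  ⟨Finset.univ.filter fun p => (p.1.1, p.2.1) ∈ G.edges⟩

/-- An isomorphism of bigraphs: it respects the two vertex classes, and it preserves and reflects
edges. -/
structure Iso (G : Bigraph V₁ V₂) (G' : Bigraph V₁' V₂') where
  left : V₁ ≃ V₁'
  right : V₂ ≃ V₂'
  edge_iff : ∀ v w, (v, w) ∈ G.edges ↔ (left v, right w) ∈ G'.edges

/-- The map on vertices of an isomorphism of bigraphs. -/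
def Iso.onVerts {G : Bigraph V₁ V₂} {G' : Bigraph V₁' V₂'} (f : G.Iso G') :
    V₁ ⊕ V₂ ≃ V₁' ⊕ V₂' :=
  Equiv.sumCongr f.left f.right

/-- `S` contains `R`, and every vertex of `S` outside `R` has degree at least `2` in the subgraph
of `G` induced by `S`. -/
def IsTwoDense (G : Bigraph V₁ V₂) (R S : Set (V₁ ⊕ V₂)) : Prop :=
  R ⊆ S ∧ ∀ v ∈ S, v ∉ R → 2 ≤ {u | u ∈ S ∧ G.graph.Adj v u}.ncard

/-- The vertex set of the largest subgraph of `G` that contains `R` and in which all vertices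
outside `R` have degree at least `2`. It is what remains when vertices outside `R` of degree less
than `2` are removed one after the other as long as there are any. -/
def coreVerts (G : Bigraph V₁ V₂) (R : Set (V₁ ⊕ V₂)) : Set (V₁ ⊕ V₂) :=
  ⋃₀ {S | G.IsTwoDense R S}

theorem subset_coreVerts (G : Bigraph V₁ V₂) (R : Set (V₁ ⊕ V₂)) : R ⊆ G.coreVerts R :=
  Set.subset_sUnion_of_mem ⟨subset_rfl, fun _ hv h => absurd hv h⟩

/-- The set `coreVerts` is indeed the largest one with the required property. -/
theorem isGreatest_coreVerts [Finite V₁] [Finite V₂] (G : Bigraph V₁ V₂) (R : Set (V₁ ⊕ V₂)) :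
    IsGreatest {S | G.IsTwoDense R S} (G.coreVerts R) := by
  refine ⟨⟨G.subset_coreVerts R, ?_⟩, fun S hS => Set.subset_sUnion_of_mem hS⟩
  rintro v ⟨S, hS, hvS⟩ hvR
  refine (hS.2 v hvS hvR).trans (Set.ncard_le_ncard ?_ (Set.toFinite _))
  exact fun u hu => ⟨Set.subset_sUnion_of_mem hS hu.1, hu.2⟩

/-- The `2`-core `C₂(G)` of a connected bigraph `G`: its largest subgraph in which all vertices
have degree at least `2` (the empty bigraph if `G` is a tree). -/
noncomputable def twoCore [Finite V₁] [Finite V₂] (G : Bigraph V₁ V₂) :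
    Bigraph (Left (G.coreVerts ∅)) (Right (G.coreVerts ∅)) :=
  G.induce (G.coreVerts ∅)

end Bigraph

/-- A flag: a bigraph some of whose vertices carry distinct labels, taken from the set `L`. -/
structure BigraphFlag (L : Type u₃) (V₁ : Type u₁) (V₂ : Type u₂) where
  toBigraph : Bigraph V₁ V₂
  label : L → V₁ ⊕ V₂
  label_injective : Function.Injective label

namespace BigraphFlag

variable {L : Type u₅} {V₁ : Type u₁} {V₂ : Type u₂} {V₁' : Type u₃} {V₂' : Type u₄}

/-- Two flags are isomorphic if there is an isomorphism of the underlying bigraphs that preserves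
the labels. -/
def IsIsomorphic (F : BigraphFlag L V₁ V₂) (F' : BigraphFlag L V₁' V₂') : Prop :=
  ∃ f : F.toBigraph.Iso F'.toBigraph, ∀ i, f.onVerts (F.label i) = F'.label i

/-- The vertex set of the `2`-core of a flag. -/
def coreVerts (F : BigraphFlag L V₁ V₂) : Set (V₁ ⊕ V₂) :=
  F.toBigraph.coreVerts (Set.range F.label)

theorem label_mem_coreVerts (F : BigraphFlag L V₁ V₂) (i : L) : F.label i ∈ F.coreVerts :=
  F.toBigraph.subset_coreVerts _ (Set.mem_range_self i)

/-- The `2`-core `C₂(F)` of a flag `F`: the largest subgraph that contains all labelled vertices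
and in which all vertices without a label have degree at least `2`, with the same labels. -/
noncomputable def twoCore [Finite V₁] [Finite V₂] (F : BigraphFlag L V₁ V₂) :
    BigraphFlag L (Bigraph.Left F.coreVerts) (Bigraph.Right F.coreVerts) where
  toBigraph := F.toBigraph.induce F.coreVerts
  label i := Bigraph.toInduced F.coreVerts (F.label i) (F.label_mem_coreVerts i)
  label_injective _ _ h := F.label_injective (Bigraph.toInduced_injective _ _ _ _ _ h)

/-- For `S ⊆ U ⊆ V(G)`, the flag `(G|_U, S)`, in which every vertex of `S` is labelled by
itself. -/
noncomputable def ofInduced [Finite V₁] [Finite V₂] (G : Bigraph V₁ V₂) (U S : Set (V₁ ⊕ V₂))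
    (h : S ⊆ U) : BigraphFlag S (Bigraph.Left U) (Bigraph.Right U) where
  toBigraph := G.induce U
  label v := Bigraph.toInduced U v.1 (h v.2)
  label_injective _ _ h' := Subtype.ext (Bigraph.toInduced_injective _ _ _ _ _ h')

end BigraphFlag

/-- A reflective tree decomposition of `G`: a tree `T` whose vertices (the bags) are subsets of
`V(G)`, such that the bags cover the vertices and the edges of `G`, the intersection of two bags
is contained in every bag on the path of `T` between them, and for every edge `{U₁, U₂}` of `T`
the flags `(G|_{U₁}, U₁ ∩ U₂)` and `(G|_{U₂}, U₁ ∩ U₂)` have isomorphic `2`-cores. -/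
structure ReflectiveTreeDecomposition {V₁ : Type u₁} {V₂ : Type u₂} [Finite V₁] [Finite V₂]
    (G : Bigraph V₁ V₂) where
  bags : Set (Set (V₁ ⊕ V₂))
  tree : SimpleGraph bags
  isTree : tree.IsTree
  cover_verts : ⋃₀ bags = Set.univ
  cover_edges : ∀ p ∈ G.edges, ∃ U ∈ bags, Sum.inl p.1 ∈ U ∧ Sum.inr p.2 ∈ U
  inter_subset : ∀ (U₁ U₂ : bags) (p : tree.Walk U₁ U₂), p.IsPath →
    ∀ U₃ ∈ p.support, U₁.1 ∩ U₂.1 ⊆ U₃.1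
  reflective : ∀ U₁ U₂ : bags, tree.Adj U₁ U₂ →
    (BigraphFlag.ofInduced G U₁.1 (U₁.1 ∩ U₂.1) Set.inter_subset_left).twoCore.IsIsomorphic
      (BigraphFlag.ofInduced G U₂.1 (U₁.1 ∩ U₂.1) Set.inter_subset_right).twoCore

/-- `H` is (a copy of) the core of the decomposition `T`, i.e. isomorphic to the `2`-core of `G|_U`
for a bag `U` of `T`. (All the bags of a reflective tree decomposition have isomorphic `2`-cores,
and there is at least one bag.) -/
def ReflectiveTreeDecomposition.IsCore {V₁ : Type u₁} {V₂ : Type u₂} [Finite V₁] [Finite V₂]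
    {G : Bigraph V₁ V₂} (T : ReflectiveTreeDecomposition G) {H₁ : Type u₃} {H₂ : Type u₄}
    (H : Bigraph H₁ H₂) : Prop :=
  ∃ U ∈ T.bags, Nonempty (H.Iso (G.induce U).twoCore)

/-- A bigraphon: a bounded measurable function `X × Y → [0, ∞)`. -/
structure IsBigraphon {X Y : Type w} [MeasurableSpace X] [MeasurableSpace Y]
    (W : X × Y → ℝ) : Prop where
  measurable : Measurable W
  nonneg : ∀ p, 0 ≤ W p
  bounded : ∃ C, ∀ p, W p ≤ C

namespace Bigraph

/-- The density `t(G, W)`. -/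
noncomputable def density {V₁ : Type u₁} {V₂ : Type u₂} [Fintype V₁] [Fintype V₂]
    (G : Bigraph V₁ V₂) {X Y : Type w} [MeasurableSpace X] [MeasurableSpace Y]
    (μ : Measure X) (ν : Measure Y) (W : X × Y → ℝ) : ℝ :=
  ∫ z : (V₁ → X) × (V₂ → Y), ∏ p ∈ G.edges, W (z.1 p.1, z.2 p.2)
    ∂((Measure.pi fun _ => μ).prod (Measure.pi fun _ => ν))

end Bigraph

/-- A function `W` on `X × Y` is biregular if almost all of its marginals are equal to
`t(ρ, W)`. -/
def IsBiregular {X Y : Type w} [MeasurableSpace X] [MeasurableSpace Y]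
    (μ : Measure X) (ν : Measure Y) (W : X × Y → ℝ) : Prop :=
  (∀ᵐ x ∂μ, ∫ y, W (x, y) ∂ν = Bigraph.rho.density μ ν W) ∧
    ∀ᵐ y ∂ν, ∫ x, W (x, y) ∂μ = Bigraph.rho.density μ ν W

namespace Bigraph

/-- `G` is a Sidorenko bigraph: `t(G, W) ≥ t(ρ, W) ^ e(G)` for every bigraphon `W`. -/
def IsSidorenko.{w', v₁, v₂} {V₁ : Type v₁} {V₂ : Type v₂} [Fintype V₁] [Fintype V₂]
    (G : Bigraph V₁ V₂) : Prop :=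
  ∀ (X Y : Type w') [MeasurableSpace X] [MeasurableSpace Y] (μ : Measure X) (ν : Measure Y)
    [IsProbabilityMeasure μ] [IsProbabilityMeasure ν] (W : X × Y → ℝ), IsBigraphon W →
    rho.density μ ν W ^ G.e ≤ G.density μ ν W

/-- `G` weakly dominates `H`: `t(H, W) / t(ρ, W) ^ e(H) ≤ t(G, W) / t(ρ, W) ^ e(G)` for every
biregular bigraphon `W` that is non-zero (that is, not almost everywhere zero, so that
`t(ρ, W) > 0`). -/
def WeaklyDominates.{w', v₁, v₂, v₃, v₄} {V₁ : Type v₁} {V₂ : Type v₂} {H₁ : Type v₃}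
    {H₂ : Type v₄} [Fintype V₁] [Fintype V₂] [Fintype H₁] [Fintype H₂]
    (G : Bigraph V₁ V₂) (H : Bigraph H₁ H₂) : Prop :=
  ∀ (X Y : Type w') [MeasurableSpace X] [MeasurableSpace Y] (μ : Measure X) (ν : Measure Y)
    [IsProbabilityMeasure μ] [IsProbabilityMeasure ν] (W : X × Y → ℝ), IsBigraphon W →
    IsBiregular μ ν W → ¬ W =ᵐ[μ.prod ν] 0 →
    H.density μ ν W / rho.density μ ν W ^ H.e ≤ G.density μ ν W / rho.density μ ν W ^ G.e

end Bigraph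

/-! Divide a non-zero biregular `W` by its density. Almost all marginals of the resulting kernel are
1, so a vertex of degree at most 1 can be integrated out without a trace. Hence the weight w_U of a
bag U, the product of the kernel over its edges, has the same marginal on a set S of labelled
vertices as the 2-core of the flag. By reflectivity, adjacent bags have the same marginal m_S on
their intersection S, and all bags have the same total weight t, namely that of `H`.

Agreeing marginals can be glued along the tree as in a Markov field: f = t⁻¹ ∏ w_U / ∏ m_S, over the
bags U and the tree edges with intersection S, is a probability density with marginal w_U / t on
every bag U. Every edge of `G` lies in a bag and the overlaps are accounted for by the sets S, so
where the quotients make sense the weight of `G` is ∏ w_U / ∏ w_S = t f ∏ (m_S / w_S). One could now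
apply Jensen's inequality to the relative entropy of f. Instead, 1 + x ≤ exp x is used twice. First,
m_S / w_S ≥ exp (1 - w_S / m_S), so with k the number of gluings and s = ∑ w_S / m_S the weight of
`G` is at least t f exp (k - s); second, this is at least t f (1 + k - s). Domination by `H` says ∫
w_S ≤ t, which gives ∫ f w_S / m_S ≤ 1 and so ∫ f s ≤ k. The integral of the weight of `G` is
therefore at least t. `GluedDensity` records f, s and k, `GluedDensity.extend` adds a bag,
`GluedDensity.le_lintegral` draws the conclusion, and `lintegral_edgeWeight_of_isIsomorphic`
supplies the equality of marginals.

Left and right vertices are both given values in the one space X × Y, and the kernel reads only the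
relevant coordinate; this avoids separate arguments for the two classes.

For the Sidorenko property, domination yields the inequality for biregular `W` only. A general `W`
is restricted to a product set where degrees are at least a quarter of the density, and is then made
biregular by dividing by the degrees and reweighting the measures by them. As `G` has no isolated
vertices, each vertex weight cancels against an incident edge, and the remaining degrees cost only a
constant depending on `G`. Tensor powers remove the constant. -/

open scoped ENNReal NNReal

/-! ### Integrating out a set of coordinates. -/

section Marginals

section

variable {V Z : Type*}

theorem DependsOn.mono_of_subset {β : Type*} {f : (V → Z) → β} {S U : Set V} (hf : DependsOn f S)
    (h : S ⊆ U) : DependsOn f U := fun _ _ hz => hf fun i hi => hz i (h hi)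

theorem DependsOn.comp₂ {β γ δ : Type*} (F : β → γ → δ) {f : (V → Z) → β} {g : (V → Z) → γ}
    {S : Set V} (hf : DependsOn f S) (hg : DependsOn g S) : DependsOn (fun z => F (f z) (g z)) S :=
  fun _ _ hz => by simp only [hf hz, hg hz]

theorem DependsOn.comp₁ {β γ : Type*} (F : β → γ) {f : (V → Z) → β}
    {S : Set V} (hf : DependsOn f S) : DependsOn (fun z => F (f z)) S :=
  fun _ _ hz => by simp only [hf hz]

end

variable {V Z : Type*} [DecidableEq V] [MeasurableSpace Z]

theorem lmarginal_mul_of_dependsOn (P : Measure Z) [SigmaFinite P] (D : Finset V) {A : Set V}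
    {u v : (V → Z) → ℝ≥0∞} (hu : DependsOn u A) (hA : ∀ i ∈ A, i ∉ D) (hv : Measurable v) :
    (∫⋯∫⁻_D, (fun z => u z * v z) ∂fun _ => P) = fun z => u z * (∫⋯∫⁻_D, v ∂fun _ => P) z := by
  funext z
  have h : ∀ y : D → Z, u (Function.updateFinset z D y) = u z := fun y =>
    hu fun i hi => by simp [Function.updateFinset, hA i hi]
  simp only [lmarginal, h]
  exact lintegral_const_mul _ (hv.comp measurable_updateFinset)

theorem lmarginal_of_dependsOn (P : Measure Z) [IsProbabilityMeasure P] (D : Finset V) {A : Set V}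
    {u : (V → Z) → ℝ≥0∞} (hu : DependsOn u A) (hA : ∀ i ∈ A, i ∉ D) :
    (∫⋯∫⁻_D, u ∂fun _ => P) = u := by
  funext z
  have h : ∀ y : D → Z, u (Function.updateFinset z D y) = u z := fun y =>
    hu fun i hi => by simp [Function.updateFinset, hA i hi]
  simp [lmarginal, h]

theorem dependsOn_lmarginal (P : Measure Z) (D : Finset V) {U : Set V}
    {u : (V → Z) → ℝ≥0∞} (hu : DependsOn u U) :
    DependsOn (∫⋯∫⁻_D, u ∂fun _ => P) (U \ D) := by
  intro z z' h
  refine lintegral_congr fun y => hu fun i hi => ?_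
  by_cases hD : i ∈ D
  · simp [Function.updateFinset, hD]
  · simpa [Function.updateFinset, hD] using h i ⟨hi, hD⟩

/-- `u` is constant in the coordinates from `D`, so both integrands have the same marginal after
integration over `D`. -/
theorem lintegral_mul_lmarginal [Fintype V] (P : Measure Z) [IsProbabilityMeasure P]
    (D : Finset V) {A : Set V}
    {u v : (V → Z) → ℝ≥0∞} (hu : DependsOn u A) (hA : ∀ i ∈ A, i ∉ D) (hum : Measurable u)
    (hv : Measurable v) :
    ∫⁻ z, u z * v z ∂(Measure.pi fun _ => P) =
      ∫⁻ z, u z * (∫⋯∫⁻_D, v ∂fun _ => P) z ∂(Measure.pi fun _ => P) := by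
  have hv' : Measurable (∫⋯∫⁻_D, v ∂fun _ => P) := hv.lmarginal _
  refine lintegral_eq_of_lmarginal_eq D (hum.mul hv) (hum.mul hv') ?_
  rw [lmarginal_mul_of_dependsOn P D hu hA hv, lmarginal_mul_of_dependsOn P D hu hA hv',
    lmarginal_of_dependsOn P D (dependsOn_lmarginal P D (dependsOn_univ v)) (by simp)]

theorem ae_mul_eq_zero {Ω : Type*} [MeasurableSpace Ω] {μ : Measure Ω} {u v : Ω → ℝ≥0∞}
    (hu : Measurable u) (hv : Measurable v) :
    ∫⁻ z, u z * v z ∂μ = 0 ↔ ∀ᵐ z ∂μ, u z * v z = 0 :=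
  lintegral_eq_zero_iff (hu.mul hv)

/-- The integral of `u` over the coordinates in `D`, as a function of all coordinates. -/
noncomputable def integrateOut {V Z : Type*} [Finite V] [MeasurableSpace Z] (P : Measure Z)
    (D : Set V) (u : (V → Z) → ℝ≥0∞) : (V → Z) → ℝ≥0∞ :=
  letI := Classical.decEq V
  ∫⋯∫⁻_D.toFinite.toFinset, u ∂fun _ => P

end Marginals

section IntegrateOut

variable {V Z : Type*} [Fintype V] [MeasurableSpace Z] {P : Measure Z} {A D U : Set V}
  {u v : (V → Z) → ℝ≥0∞}

theorem Measurable.integrateOut [SigmaFinite P] (hu : Measurable u) :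
    Measurable (integrateOut P D u) := by
  let := Classical.decEq V
  exact hu.lmarginal _

theorem dependsOn_integrateOut (hu : DependsOn u U) : DependsOn (integrateOut P D u) (U \ D) := by
  let := Classical.decEq V
  exact (dependsOn_lmarginal P D.toFinite.toFinset hu).mono_of_subset (by simp)

theorem lintegral_mul_integrateOut [IsProbabilityMeasure P] (hu : DependsOn u A)
    (hA : Disjoint A D) (hum : Measurable u) (hv : Measurable v) :
    ∫⁻ z, u z * v z ∂(Measure.pi fun _ => P) =
      ∫⁻ z, u z * integrateOut P D v z ∂(Measure.pi fun _ => P) := by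
  let := Classical.decEq V
  exact lintegral_mul_lmarginal P D.toFinite.toFinset hu
    (fun i hi => by simpa using Set.disjoint_left.1 hA hi) hum hv

theorem integrateOut_le [IsProbabilityMeasure P] {c : ℝ≥0∞} (hu : ∀ z, u z ≤ c) (z : V → Z) :
    integrateOut P D u z ≤ c := by
  let := Classical.decEq V
  calc _ ≤ ∫⁻ _, c ∂(Measure.pi fun _ : D.toFinite.toFinset => P) :=
        lintegral_mono fun y => hu _
    _ = c := by simp

end IntegrateOut

/-! ### Products of kernel values over edges. -/

section EdgeWeights

variable {V₁ : Type u₁} {V₂ : Type u₂} {Z : Type*}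

/-- The product of the weights `K` over the edges in `F`. -/
def edgeWeight (K : Z → Z → ℝ≥0) (F : Finset (V₁ × V₂)) (z : V₁ ⊕ V₂ → Z) : ℝ≥0 :=
  ∏ p ∈ F, K (z (Sum.inl p.1)) (z (Sum.inr p.2))

open Classical in
/-- The edges of `G` both of whose ends lie in `A`. -/
noncomputable def Bigraph.within (G : Bigraph V₁ V₂) (A : Set (V₁ ⊕ V₂)) : Finset (V₁ × V₂) :=
  G.edges.filter fun p => Sum.inl p.1 ∈ A ∧ Sum.inr p.2 ∈ A

theorem Bigraph.mem_within {G : Bigraph V₁ V₂} {A : Set (V₁ ⊕ V₂)} {p : V₁ × V₂} :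
    p ∈ G.within A ↔ p ∈ G.edges ∧ Sum.inl p.1 ∈ A ∧ Sum.inr p.2 ∈ A := by
  simp [Bigraph.within]

theorem Bigraph.within_mono (G : Bigraph V₁ V₂) {A B : Set (V₁ ⊕ V₂)} (h : A ⊆ B) :
    G.within A ⊆ G.within B := fun p hp => by
  rw [mem_within] at hp ⊢
  exact ⟨hp.1, h hp.2.1, h hp.2.2⟩

theorem dependsOn_edgeWeight (K : Z → Z → ℝ≥0) (G : Bigraph V₁ V₂) (A : Set (V₁ ⊕ V₂)) :
    DependsOn (edgeWeight K (G.within A)) A := by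
  intro z z' h
  refine Finset.prod_congr rfl fun p hp => ?_
  rw [Bigraph.mem_within] at hp
  rw [h _ hp.2.1, h _ hp.2.2]

theorem measurable_edgeWeight [MeasurableSpace Z] {K : Z → Z → ℝ≥0}
    (hK : Measurable (Function.uncurry K)) (F : Finset (V₁ × V₂)) :
    Measurable (edgeWeight K F) := by
  refine Finset.measurable_fun_prod _ fun p _ => ?_
  exact hK.comp (f := fun z : V₁ ⊕ V₂ → Z => (z (Sum.inl p.1), z (Sum.inr p.2))) (by fun_prop)

theorem edgeWeight_le {K : Z → Z → ℝ≥0} {C : ℝ≥0} (hC : ∀ z z', K z z' ≤ C)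
    (F : Finset (V₁ × V₂)) (z : V₁ ⊕ V₂ → Z) : edgeWeight K F z ≤ C ^ F.card :=
  Finset.prod_le_pow_card _ _ _ fun _ _ => hC _ _

end EdgeWeights

/-! ### Glued densities and the lower bound they certify. -/

section Gluing

variable {V₁ : Type u₁} {V₂ : Type u₂} [Fintype V₁] [Fintype V₂] {Z : Type*} [MeasurableSpace Z]

/-- A witness that the edges in `F` have weight at least `t`: a density `f` whose marginals on the
bags in `B` are the normalised edge weights, together with a bound for the relative entropy of
`f`. -/
structure GluedDensity (P : Measure Z) (K : Z → Z → ℝ≥0) (G : Bigraph V₁ V₂) (t : ℝ≥0)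
    (F : Finset (V₁ × V₂)) (A : Set (V₁ ⊕ V₂)) (B : Set (Set (V₁ ⊕ V₂))) where
  f : (V₁ ⊕ V₂ → Z) → ℝ≥0
  s : (V₁ ⊕ V₂ → Z) → ℝ≥0
  k : ℕ
  measurable_f : Measurable f
  measurable_s : Measurable s
  dependsOn_f : DependsOn f A
  dependsOn_s : DependsOn s A
  le_weight : ∀ z, (t : ℝ) * f z * Real.exp (k - s z) ≤ edgeWeight K F z
  lintegral_s : ∫⁻ z, (f z : ℝ≥0∞) * s z ∂(Measure.pi fun _ => P) ≤ k
  marginal : ∀ U ∈ B, ∀ g : (V₁ ⊕ V₂ → Z) → ℝ≥0∞, Measurable g → DependsOn g U →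
    t * ∫⁻ z, f z * g z ∂(Measure.pi fun _ => P) =
      ∫⁻ z, edgeWeight K (G.within U) z * g z ∂(Measure.pi fun _ => P)

namespace GluedDensity

variable {P : Measure Z} [IsProbabilityMeasure P] {K : Z → Z → ℝ≥0} {G : Bigraph V₁ V₂} {t : ℝ≥0}

/-- The witness for a single bag. -/
noncomputable def single (hK : Measurable (Function.uncurry K)) (ht : t ≠ 0)
    (U : Set (V₁ ⊕ V₂)) : GluedDensity P K G t (G.within U) U {U} where
  f z := edgeWeight K (G.within U) z / t
  s _ := 0
  k := 0
  measurable_f := (measurable_edgeWeight hK _).div_const _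
  measurable_s := measurable_const
  dependsOn_f := DependsOn.comp₁ (· / t) (dependsOn_edgeWeight K G U)
  dependsOn_s := fun _ _ _ => rfl
  le_weight z := by
    have : (t : ℝ) ≠ 0 := by exact_mod_cast ht
    simp only [NNReal.coe_div, Nat.cast_zero, NNReal.coe_zero, sub_zero, Real.exp_zero, mul_one]
    rw [mul_div_cancel₀ _ this]
  lintegral_s := by simp
  marginal := by
    intro U' hU' g hg _
    obtain rfl : U' = U := hU'
    have hm := measurable_edgeWeight (V₁ := V₁) (V₂ := V₂) hK
    have hm' : Measurable fun z => ((edgeWeight K (G.within U') z / t : ℝ≥0) : ℝ≥0∞) * g z :=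
      ((hm _).div_const _).coe_nnreal_ennreal.mul hg
    rw [← lintegral_const_mul _ hm']
    refine lintegral_congr fun z => ?_
    rw [← mul_assoc, ← ENNReal.coe_mul, mul_div_cancel₀ _ ht]

omit [IsProbabilityMeasure P] in
-- By 1 + x ≤ exp x the weight is at least t f (1 + k - s); integrate, using that f has mass 1 and
-- that the integral of f s is at most k.
theorem le_lintegral {F : Finset (V₁ × V₂)} {A : Set (V₁ ⊕ V₂)} {B : Set (Set (V₁ ⊕ V₂))}
    (X : GluedDensity P K G t F A B) (hK : Measurable (Function.uncurry K)) (ht : t ≠ 0)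
    {U : Set (V₁ ⊕ V₂)} (hU : U ∈ B)
    (hUt : ∫⁻ z, edgeWeight K (G.within U) z ∂(Measure.pi fun _ => P) = t) :
    (t : ℝ≥0∞) ≤ ∫⁻ z, edgeWeight K F z ∂(Measure.pi fun _ => P) := by
  have hf1 : ∫⁻ z, (X.f z : ℝ≥0∞) ∂(Measure.pi fun _ => P) = 1 := by
    have h := X.marginal U hU (fun _ => 1) measurable_const fun _ _ _ => rfl
    simp only [mul_one, hUt] at h
    exact (ENNReal.mul_eq_left (by simpa using ht) ENNReal.coe_ne_top).1 h
  -- The term with `s` stands on the right because subtraction in `ℝ≥0∞` is truncated.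
  have hpt : ∀ z, (t : ℝ≥0∞) * ((1 + X.k) * X.f z) ≤
      edgeWeight K F z + t * (X.f z * X.s z) := by
    intro z
    have h1 := X.le_weight z
    have h2 := Real.add_one_le_exp ((X.k : ℝ) - X.s z)
    have h3 : (t : ℝ) * ((1 + X.k) * X.f z) ≤ edgeWeight K F z + t * (X.f z * X.s z) := by
      have := mul_le_mul_of_nonneg_left h2 (by positivity : 0 ≤ (t : ℝ) * X.f z)
      linarith
    exact_mod_cast h3
  have hint := lintegral_mono (μ := Measure.pi fun _ : V₁ ⊕ V₂ => P) hpt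
  have hfm := X.measurable_f.coe_nnreal_ennreal
  have hsm : Measurable fun z => (X.f z : ℝ≥0∞) * X.s z :=
    hfm.mul X.measurable_s.coe_nnreal_ennreal
  rw [lintegral_const_mul _ (hfm.const_mul _), lintegral_const_mul _ hfm, hf1,
    lintegral_add_left (measurable_edgeWeight hK F).coe_nnreal_ennreal,
    lintegral_const_mul _ hsm, mul_one, mul_add, mul_one] at hint
  have h4 := hint.trans (add_le_add le_rfl (mul_le_mul_right X.lintegral_s (t : ℝ≥0∞)))
  -- Now t + t k ≤ ∫ w + t k, and the finite term t k cancels.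
  refine (ENNReal.add_le_add_iff_right ?_).1 h4
  exact ENNReal.mul_ne_top ENNReal.coe_ne_top (ENNReal.natCast_ne_top _)

end GluedDensity
end Gluing

/-! ### Gluing one more bag to a density. -/

section Extension

variable {V₁ : Type u₁} {V₂ : Type u₂} [Fintype V₁] [Fintype V₂] {Z : Type*} [MeasurableSpace Z]

/-- The marginal of the weight of the bag `U` on the vertices in `S`. -/
noncomputable def bagMarginal (P : Measure Z) (K : Z → Z → ℝ≥0) (G : Bigraph V₁ V₂)
    (U S : Set (V₁ ⊕ V₂)) (z : V₁ ⊕ V₂ → Z) : ℝ≥0 :=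
  (integrateOut P (U \ S) (fun z => (edgeWeight K (G.within U) z : ℝ≥0∞)) z).toNNReal

variable {P : Measure Z} [IsProbabilityMeasure P] {K : Z → Z → ℝ≥0} {G : Bigraph V₁ V₂} {t : ℝ≥0}
  {U S : Set (V₁ ⊕ V₂)}

/-- A bounded kernel has finite marginals, so `toNNReal` loses nothing. -/
theorem coe_bagMarginal (hC : ∃ C, ∀ z z', K z z' ≤ C) (z : V₁ ⊕ V₂ → Z) :
    (bagMarginal P K G U S z : ℝ≥0∞) =
      integrateOut P (U \ S) (fun z => (edgeWeight K (G.within U) z : ℝ≥0∞)) z := by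
  obtain ⟨C, hC⟩ := hC
  exact ENNReal.coe_toNNReal (ne_top_of_le_ne_top ENNReal.coe_ne_top
    (integrateOut_le (fun z => ENNReal.coe_le_coe.2 (edgeWeight_le hC _ z)) z))

omit [IsProbabilityMeasure P] in
theorem measurable_bagMarginal [SigmaFinite P] (hK : Measurable (Function.uncurry K)) :
    Measurable (bagMarginal P K G U S) :=
  (measurable_edgeWeight hK _).coe_nnreal_ennreal.integrateOut.ennreal_toNNReal

omit [IsProbabilityMeasure P] in
theorem dependsOn_bagMarginal : DependsOn (bagMarginal P K G U S) S := by
  have h : DependsOn (fun z => (edgeWeight K (G.within U) z : ℝ≥0∞)) U :=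
    DependsOn.comp₁ (fun r : ℝ≥0 => (r : ℝ≥0∞)) (dependsOn_edgeWeight K G U)
  exact DependsOn.comp₁ ENNReal.toNNReal ((dependsOn_integrateOut (P := P) (D := U \ S)
    h).mono_of_subset (by simp))

theorem lintegral_mul_bagMarginal (hK : Measurable (Function.uncurry K))
    (hC : ∃ C, ∀ z z', K z z' ≤ C) {g : (V₁ ⊕ V₂ → Z) → ℝ≥0∞}
    (hg : Measurable g) (hgS : DependsOn g S) :
    ∫⁻ z, g z * edgeWeight K (G.within U) z ∂(Measure.pi fun _ => P) =
      ∫⁻ z, g z * bagMarginal P K G U S z ∂(Measure.pi fun _ => P) := by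
  rw [lintegral_mul_integrateOut hgS (D := U \ S) Set.disjoint_sdiff_right hg
    (measurable_edgeWeight hK _).coe_nnreal_ennreal]
  exact lintegral_congr fun z => by rw [coe_bagMarginal hC]

/-- Test the defining property of the marginal m against the indicator function of m = 0. This makes
divisions by m harmless. -/
theorem edgeWeight_eq_zero_of_bagMarginal (hK : Measurable (Function.uncurry K))
    (hC : ∃ C, ∀ z z', K z z' ≤ C) :
    ∀ᵐ z ∂(Measure.pi fun _ => P), bagMarginal P K G U S z = 0 →
      edgeWeight K (G.within U) z = 0 := by
  have hm := measurable_bagMarginal (P := P) (G := G) (U := U) (S := S) hK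
  let i : ℝ≥0 → ℝ≥0∞ := fun r => if r = 0 then 1 else 0
  have hi : Measurable i := Measurable.ite (measurableSet_singleton 0) measurable_const
    measurable_const
  have h := lintegral_mul_bagMarginal (P := P) (G := G) (U := U) (S := S) hK hC (hi.comp hm)
    (DependsOn.comp₁ i dependsOn_bagMarginal)
  have h0 : ∀ z, (i ∘ bagMarginal P K G U S) z * bagMarginal P K G U S z = 0 := fun z => by
    by_cases hz : bagMarginal P K G U S z = 0 <;> simp [i, hz]
  simp only [h0, lintegral_zero] at h
  rw [ae_mul_eq_zero (hi.comp hm) (measurable_edgeWeight hK _).coe_nnreal_ennreal] at h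
  filter_upwards [h] with z hz hz0
  simpa [i, hz0] using hz

namespace GluedDensity

/-- The pointwise inequality behind the extension of a glued density by one bag. -/
theorem weight_step {t f s m a b c d k : ℝ} (hm : 0 ≤ m)
    (ha : 0 ≤ a) (hb : 0 ≤ b) (hc : 0 ≤ c) (hd : 0 ≤ d)
    (h : t * f * Real.exp (k - s) ≤ a) (hab : d * c = a * b) (h0 : c = 0 → b = 0) :
    t * (f * (b / m)) * Real.exp (k + 1 - (s + c / m)) ≤ d := by
  rcases hm.eq_or_lt with rfl | hm
  · simpa using hd
  rcases hc.eq_or_lt with rfl | hc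
  · simpa [h0 rfl] using hd
  -- The tangent line inequality x ≤ exp (x - 1) at x = c / m; it takes the place of the concavity
  -- of the logarithm.
  have h1 : Real.exp (1 - c / m) * c ≤ m := by
    have h2 := Real.add_one_le_exp (c / m - 1)
    rw [sub_add_cancel] at h2
    have h3 : c ≤ Real.exp (c / m - 1) * m := (div_le_iff₀ hm).1 h2
    calc Real.exp (1 - c / m) * c ≤ Real.exp (1 - c / m) * (Real.exp (c / m - 1) * m) := by gcongr
      _ = m := by rw [← mul_assoc, ← Real.exp_add]; simp
  refine le_of_mul_le_mul_right ?_ hc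
  rw [hab]
  calc t * (f * (b / m)) * Real.exp (k + 1 - (s + c / m)) * c
      = (t * f * Real.exp (k - s)) * (b / m) * (Real.exp (1 - c / m) * c) := by
        rw [show k + 1 - (s + c / m) = (k - s) + (1 - c / m) by ring, Real.exp_add]; ring
    _ ≤ a * (b / m) * m := by gcongr
    _ = a * b := by field_simp

open Classical in
/-- Extension of a glued density by one more bag. -/
theorem extend {F : Finset (V₁ × V₂)} {A : Set (V₁ ⊕ V₂)} {B : Set (Set (V₁ ⊕ V₂))}
    (X : GluedDensity P K G t F A B) (hK : Measurable (Function.uncurry K))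
    (hC : ∃ C, ∀ z z', K z z' ≤ C) (ht : t ≠ 0) {U' U : Set (V₁ ⊕ V₂)} (hU' : U' ∈ B)
    (hBA : ∀ U ∈ B, U ⊆ A) (hAU : A ∩ U ⊆ U')
    (hF : F ∩ G.within U = G.within (U' ∩ U))
    (hrefl : ∀ g : (V₁ ⊕ V₂ → Z) → ℝ≥0∞, Measurable g → DependsOn g (U' ∩ U) →
      ∫⁻ z, edgeWeight K (G.within U') z * g z ∂(Measure.pi fun _ => P) =
        ∫⁻ z, edgeWeight K (G.within U) z * g z ∂(Measure.pi fun _ => P))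
    (hS : ∫⁻ z, edgeWeight K (G.within (U' ∩ U)) z ∂(Measure.pi fun _ => P) ≤ t) :
    Nonempty (GluedDensity P K G t (F ∪ G.within U) (A ∪ U) (insert U B)) := by
  set S := U' ∩ U with hSdef
  have hSU : S ⊆ U := Set.inter_subset_right
  have hSU' : S ⊆ U' := Set.inter_subset_left
  have hSA : S ⊆ A := hSU'.trans (hBA _ hU')
  -- The vertices of `U` outside `S` are new, so old functions are constant in them.
  have hAD : Disjoint A (U \ S) :=
    Set.disjoint_left.2 fun i hi hi' => hi'.2 ⟨hAU ⟨hi, hi'.1⟩, hi'.1⟩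
  have hSD : Disjoint S (U \ S) := Set.disjoint_sdiff_right
  set m := bagMarginal P K G U S with hmdef
  have hm : Measurable m := measurable_bagMarginal hK
  have hmS : DependsOn m S := dependsOn_bagMarginal
  have hw := fun F : Finset (V₁ × V₂) => measurable_edgeWeight (V₁ := V₁) (V₂ := V₂) hK F
  have hwE := fun F : Finset (V₁ × V₂) => (hw F).coe_nnreal_ennreal
  have hf := X.measurable_f
  have hfE := hf.coe_nnreal_ennreal
  have hs := X.measurable_s
  have hsE := hs.coe_nnreal_ennreal
  have hminv : Measurable fun z => ((m z)⁻¹ : ℝ≥0) := hm.inv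
  have hminvE := hminv.coe_nnreal_ennreal
  have hminvS : DependsOn (fun z => (((m z)⁻¹ : ℝ≥0) : ℝ≥0∞)) S :=
    DependsOn.comp₁ (fun r : ℝ≥0 => ((r⁻¹ : ℝ≥0) : ℝ≥0∞)) hmS
  have hw0 := edgeWeight_eq_zero_of_bagMarginal (P := P) (G := G) (U := U) (S := S) hK hC
  have htE : (t : ℝ≥0∞) ≠ 0 := by exact_mod_cast ht
  -- `f` vanishes where `m` does
  have hf0 : ∀ᵐ z ∂(Measure.pi fun _ => P), m z = 0 → X.f z = 0 := by
    let i : ℝ≥0 → ℝ≥0∞ := fun r => if r = 0 then 1 else 0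
    have hi : Measurable i := Measurable.ite (measurableSet_singleton 0) measurable_const
      measurable_const
    have hiS : DependsOn (fun z => i (m z)) S := DependsOn.comp₁ i hmS
    have him : Measurable fun z => i (m z) := hi.comp hm
    have h1 := X.marginal U' hU' _ him (hiS.mono_of_subset hSU')
    rw [hrefl _ him hiS] at h1
    have h2 : ∫⁻ z, (edgeWeight K (G.within U) z : ℝ≥0∞) * i (m z) ∂(Measure.pi fun _ => P) = 0 := by
      rw [ae_mul_eq_zero (hwE _) him]
      filter_upwards [hw0] with z hz
      by_cases h : m z = 0
      · simp [hz h]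
      · simp [i, h]
    rw [h2, mul_eq_zero, or_iff_right htE, ae_mul_eq_zero hfE him] at h1
    filter_upwards [h1] with z hz hz0
    simpa [i, hz0] using hz
  -- the new factor integrates to `1` over the new vertices
  have hnew : ∀ u : (V₁ ⊕ V₂ → Z) → ℝ≥0∞, Measurable u → DependsOn u A →
      ∫⁻ z, ((X.f z * (edgeWeight K (G.within U) z / m z) : ℝ≥0) : ℝ≥0∞) * u z
        ∂(Measure.pi fun _ => P) = ∫⁻ z, X.f z * u z ∂(Measure.pi fun _ => P) := by
    intro u hu huA
    have hdep : DependsOn (fun z => (X.f z : ℝ≥0∞) * u z * (((m z)⁻¹ : ℝ≥0) : ℝ≥0∞)) A :=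
      DependsOn.comp₂ (fun a b : ℝ≥0∞ => a * b)
        (DependsOn.comp₂ (fun (a : ℝ≥0) (b : ℝ≥0∞) => a * b) X.dependsOn_f huA)
        (hminvS.mono_of_subset hSA)
    have h := lintegral_mul_integrateOut (P := P) hdep hAD ((hfE.mul hu).mul hminvE)
      (hwE (G.within U))
    calc _ = _ := lintegral_congr fun z => by
            rw [div_eq_mul_inv]; push_cast; ring
      _ = _ := h
      _ = _ := lintegral_congr_ae ?_
    filter_upwards [hf0] with z hz
    rw [← coe_bagMarginal hC, ← hmdef]
    by_cases h : m z = 0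
    · simp [hz h]
    · rw [mul_assoc, ← ENNReal.coe_mul, inv_mul_cancel₀ h]; simp
  -- Integrating out the new vertices leaves a function of `S` against the old density. The old
  -- marginal on `U'` and reflectivity turn this into an integral against m / t, and m cancels the
  -- denominator.
  have hmargU : ∀ g : (V₁ ⊕ V₂ → Z) → ℝ≥0∞, Measurable g → DependsOn g U →
      t * ∫⁻ z, ((X.f z * (edgeWeight K (G.within U) z / m z) : ℝ≥0) : ℝ≥0∞) * g z
        ∂(Measure.pi fun _ => P) =
      ∫⁻ z, edgeWeight K (G.within U) z * g z ∂(Measure.pi fun _ => P) := by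
    intro g hg hgU
    have hwg : Measurable fun z => (edgeWeight K (G.within U) z : ℝ≥0∞) * g z := (hwE _).mul hg
    have hwgU : DependsOn (fun z => (edgeWeight K (G.within U) z : ℝ≥0∞) * g z) U :=
      DependsOn.comp₂ (fun (a : ℝ≥0) (b : ℝ≥0∞) => a * b) (dependsOn_edgeWeight K G U) hgU
    set h := integrateOut P (U \ S)
      (fun z => (edgeWeight K (G.within U) z : ℝ≥0∞) * g z) with hh
    have hhm : Measurable h := hwg.integrateOut
    have hhS : DependsOn h S := (dependsOn_integrateOut hwgU).mono_of_subset (by simp [hSdef])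
    have hmhS : DependsOn (fun z => (((m z)⁻¹ : ℝ≥0) : ℝ≥0∞) * h z) S :=
      DependsOn.comp₂ (fun a b : ℝ≥0∞ => a * b) hminvS hhS
    have hmh : Measurable fun z => (((m z)⁻¹ : ℝ≥0) : ℝ≥0∞) * h z := hminvE.mul hhm
    have h1 : ∫⁻ z, ((X.f z * (edgeWeight K (G.within U) z / m z) : ℝ≥0) : ℝ≥0∞) * g z
        ∂(Measure.pi fun _ => P) =
        ∫⁻ z, X.f z * ((((m z)⁻¹ : ℝ≥0) : ℝ≥0∞) * h z) ∂(Measure.pi fun _ => P) := by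
      have hdep : DependsOn (fun z => (X.f z : ℝ≥0∞) * (((m z)⁻¹ : ℝ≥0) : ℝ≥0∞)) A :=
        DependsOn.comp₂ (fun (a : ℝ≥0) (b : ℝ≥0∞) => a * b) X.dependsOn_f
          (hminvS.mono_of_subset hSA)
      have h2 := lintegral_mul_integrateOut (P := P) hdep hAD (hfE.mul hminvE) hwg
      calc _ = _ := lintegral_congr fun z => by rw [div_eq_mul_inv]; push_cast; ring
        _ = _ := h2
        _ = _ := lintegral_congr fun z => by rw [mul_assoc]
    have h3 : DependsOn (fun z => (((m z)⁻¹ : ℝ≥0) : ℝ≥0∞) * m z) S :=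
      DependsOn.comp₂ (fun (a : ℝ≥0∞) (b : ℝ≥0) => a * b) hminvS hmS
    have h4 := lintegral_mul_integrateOut (P := P) h3 hSD
      (hminvE.mul hm.coe_nnreal_ennreal) hwg
    rw [h1, X.marginal U' hU' _ hmh (hmhS.mono_of_subset hSU'), hrefl _ hmh hmhS]
    calc _ = ∫⁻ z, (((m z)⁻¹ : ℝ≥0) : ℝ≥0∞) * h z * edgeWeight K (G.within U) z
          ∂(Measure.pi fun _ => P) := lintegral_congr fun z => mul_comm _ _
      _ = ∫⁻ z, (((m z)⁻¹ : ℝ≥0) : ℝ≥0∞) * h z * m z ∂(Measure.pi fun _ => P) :=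
          lintegral_mul_bagMarginal hK hC hmh hmhS
      _ = ∫⁻ z, (((m z)⁻¹ : ℝ≥0) : ℝ≥0∞) * m z * h z ∂(Measure.pi fun _ => P) :=
          lintegral_congr fun z => by ring
      _ = _ := h4.symm
      _ = _ := lintegral_congr_ae ?_
    filter_upwards [hw0] with z hz
    by_cases h : m z = 0
    · simp [hz h]
    · rw [← ENNReal.coe_mul, inv_mul_cancel₀ h]; simp
  have hcS : DependsOn (fun z => edgeWeight K (G.within S) z / m z) S :=
    DependsOn.comp₂ (fun a b : ℝ≥0 => a / b) (dependsOn_edgeWeight K G S) hmS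
  have hcm : Measurable fun z => edgeWeight K (G.within S) z / m z := (hw _).div hm
  have hcmE := hcm.coe_nnreal_ennreal
  -- The new vertices are distributed by the conditional density w_U / m given `S`, and `s` gains
  -- the summand w_S / m. Where m = 0 both quotients are 0.
  refine ⟨⟨fun z => X.f z * (edgeWeight K (G.within U) z / m z),
    fun z => X.s z + edgeWeight K (G.within S) z / m z, X.k + 1, hf.mul ((hw _).div hm),
    hs.add hcm, ?_, ?_, ?_, ?_, ?_⟩⟩
  · refine DependsOn.comp₂ (fun a b : ℝ≥0 => a * b)
      (X.dependsOn_f.mono_of_subset Set.subset_union_left)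
      (DependsOn.mono_of_subset ?_ (Set.subset_union_right (s := A)))
    exact DependsOn.comp₂ (fun a b : ℝ≥0 => a / b) (dependsOn_edgeWeight K G U)
      (hmS.mono_of_subset hSU)
  · exact DependsOn.comp₂ (fun a b : ℝ≥0 => a + b)
      (X.dependsOn_s.mono_of_subset Set.subset_union_left)
      (hcS.mono_of_subset (hSA.trans Set.subset_union_left))
  · intro z
    have h1 : edgeWeight K (F ∪ G.within U) z * edgeWeight K (G.within S) z =
        edgeWeight K F z * edgeWeight K (G.within U) z := by
      rw [← hF]; exact Finset.prod_union_inter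
    have h2 : edgeWeight K (G.within S) z = 0 → edgeWeight K (G.within U) z = 0 := fun h => by
      rw [edgeWeight, Finset.prod_eq_zero_iff] at h ⊢
      obtain ⟨p, hp, h⟩ := h
      exact ⟨p, G.within_mono hSU hp, h⟩
    push_cast
    exact weight_step (m z).2 (edgeWeight K F z).2
      (edgeWeight K (G.within U) z).2 (edgeWeight K (G.within S) z).2
      (edgeWeight K (F ∪ G.within U) z).2 (X.le_weight z) (congrArg NNReal.toReal h1)
      (by exact_mod_cast h2)
  · have hfnew : Measurable fun z =>
        ((X.f z * (edgeWeight K (G.within U) z / m z) : ℝ≥0) : ℝ≥0∞) :=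
      (hf.mul ((hw _).div hm)).coe_nnreal_ennreal
    -- t times the integral is ∫ w_U w_S / m = ∫ m (w_S / m) ≤ ∫ w_S ≤ t. The first inequality may
    -- be strict, since w_S / m is 0 where m is.
    have h1 : ∫⁻ z, ((X.f z * (edgeWeight K (G.within U) z / m z) : ℝ≥0) : ℝ≥0∞) *
        ((edgeWeight K (G.within S) z / m z : ℝ≥0) : ℝ≥0∞) ∂(Measure.pi fun _ => P) ≤ 1 := by
      have h2 := hmargU _ hcmE (DependsOn.comp₁ (fun r : ℝ≥0 => (r : ℝ≥0∞))
        (hcS.mono_of_subset hSU))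
      have h3 : ∫⁻ z, (edgeWeight K (G.within U) z : ℝ≥0∞) *
          ((edgeWeight K (G.within S) z / m z : ℝ≥0) : ℝ≥0∞) ∂(Measure.pi fun _ => P) ≤ t := by
        calc _ = ∫⁻ z, ((edgeWeight K (G.within S) z / m z : ℝ≥0) : ℝ≥0∞) *
              edgeWeight K (G.within U) z ∂(Measure.pi fun _ => P) :=
              lintegral_congr fun z => mul_comm _ _
          _ = ∫⁻ z, ((edgeWeight K (G.within S) z / m z : ℝ≥0) : ℝ≥0∞) * m z
              ∂(Measure.pi fun _ => P) :=
              lintegral_mul_bagMarginal hK hC hcmE (DependsOn.comp₁ (fun r : ℝ≥0 => (r : ℝ≥0∞)) hcS)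
          _ ≤ ∫⁻ z, edgeWeight K (G.within S) z ∂(Measure.pi fun _ => P) := by
              refine lintegral_mono fun z => ?_
              rw [← ENNReal.coe_mul, ENNReal.coe_le_coe]
              rcases eq_or_ne (m z) 0 with h | h
              · simp [h]
              · rw [div_mul_cancel₀ _ h]
          _ ≤ t := hS
      rw [← h2] at h3
      by_contra hlt
      push Not at hlt
      have := (ENNReal.mul_lt_mul_iff_right htE ENNReal.coe_ne_top).2 hlt
      rw [mul_one] at this
      exact absurd h3 this.not_ge
    have h2 := hnew (fun z => (X.s z : ℝ≥0∞)) hsE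
      (DependsOn.comp₁ (fun r : ℝ≥0 => (r : ℝ≥0∞)) X.dependsOn_s)
    have hA : Measurable fun z =>
        ((X.f z * (edgeWeight K (G.within U) z / m z) : ℝ≥0) : ℝ≥0∞) * (X.s z : ℝ≥0∞) :=
      hfnew.mul hsE
    calc _ = ∫⁻ z, (((X.f z * (edgeWeight K (G.within U) z / m z) : ℝ≥0) : ℝ≥0∞) * X.s z +
          ((X.f z * (edgeWeight K (G.within U) z / m z) : ℝ≥0) : ℝ≥0∞) *
            ((edgeWeight K (G.within S) z / m z : ℝ≥0) : ℝ≥0∞)) ∂(Measure.pi fun _ => P) :=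
          lintegral_congr fun z => by rw [ENNReal.coe_add, mul_add]
      _ ≤ _ := by
          rw [lintegral_add_left hA, h2]
          push_cast
          exact add_le_add X.lintegral_s (by exact_mod_cast h1)
  · rintro U₁ (rfl | hU₁) g hg hgU
    · exact hmargU g hg hgU
    · rw [hnew g hg (hgU.mono_of_subset (hBA _ hU₁))]
      exact X.marginal U₁ hU₁ g hg hgU

end GluedDensity
end Extension

/-! ### Growing a connected set of bags to the whole tree. -/

section TreeGrowth

variable {V₁ : Type u₁} {V₂ : Type u₂} [Fintype V₁] [Fintype V₂] {Z : Type*} [MeasurableSpace Z]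
  {P : Measure Z} [IsProbabilityMeasure P] {K : Z → Z → ℝ≥0} {G : Bigraph V₁ V₂} {t : ℝ≥0}

namespace ReflectiveTreeDecomposition

open Classical in
/-- The edges of `G` that are contained in a bag of `B`. -/
noncomputable def edgesIn (T : ReflectiveTreeDecomposition G) (B : Finset T.bags) :
    Finset (V₁ × V₂) :=
  B.biUnion fun U => G.within U.1

/-- `B` spans a connected subgraph of the tree. -/
def PathConnected (T : ReflectiveTreeDecomposition G) (B : Finset T.bags) : Prop :=
  ∀ a ∈ B, ∀ b ∈ B, ∃ p : T.tree.Walk a b, p.IsPath ∧ ∀ c ∈ p.support, c ∈ B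

open Classical in
theorem pathConnected_insert (T : ReflectiveTreeDecomposition G) {B : Finset T.bags}
    (hB : T.PathConnected B) {U' U : T.bags} (hU' : U' ∈ B) (hU : U ∉ B) (hadj : T.tree.Adj U' U) :
    T.PathConnected (insert U B) := by
  have key : ∀ a ∈ B, ∃ p : T.tree.Walk a U, p.IsPath ∧ ∀ c ∈ p.support, c ∈ insert U B := by
    intro a ha
    obtain ⟨p, hp, hpB⟩ := hB a ha U' hU'
    refine ⟨p.concat hadj, hp.concat (fun h => hU (hpB _ h)) hadj, fun c hc => ?_⟩
    rw [SimpleGraph.Walk.support_concat, List.mem_append, List.mem_singleton] at hc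
    rcases hc with hc | rfl
    · exact Finset.mem_insert_of_mem (hpB c hc)
    · exact Finset.mem_insert_self _ _
  intro a ha b hb
  rcases Finset.mem_insert.1 ha with rfl | haB <;> rcases Finset.mem_insert.1 hb with rfl | hbB
  · exact ⟨.nil, .nil, by simp⟩
  · obtain ⟨p, hp, h⟩ := key b hbB
    exact ⟨p.reverse, hp.reverse, by simpa using h⟩
  · exact key a haB
  · obtain ⟨p, hp, h⟩ := hB a haB b hbB
    exact ⟨p, hp, fun c hc => Finset.mem_insert_of_mem (h c hc)⟩

/-- The path inside `B` from `U₁` to `U'`, prolonged to `U`, is the tree path from `U₁` to `U`, and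
it passes through `U'`. -/
theorem inter_subset_of_adj (T : ReflectiveTreeDecomposition G) {B : Finset T.bags}
    (hB : T.PathConnected B) {U' U : T.bags} (hU' : U' ∈ B) (hU : U ∉ B) (hadj : T.tree.Adj U' U)
    {U₁ : T.bags} (hU₁ : U₁ ∈ B) : U₁.1 ∩ U.1 ⊆ U'.1 := by
  obtain ⟨p, hp, hpB⟩ := hB U₁ hU₁ U' hU'
  refine T.inter_subset _ _ (p.concat hadj) (hp.concat (fun h => hU (hpB _ h)) hadj) U' ?_
  rw [SimpleGraph.Walk.support_concat]
  simp

/-- If the weights of adjacent bags have the same marginals on their intersection, all bags have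
weight `t`, and the intersections of adjacent bags have weight at most `t`, then `G` has weight
at least `t`. -/
theorem le_lintegral_edgeWeight (T : ReflectiveTreeDecomposition G)
    (hK : Measurable (Function.uncurry K)) (hC : ∃ C, ∀ z z', K z z' ≤ C) (ht : t ≠ 0)
    (hbag : ∀ U ∈ T.bags, ∫⁻ z, edgeWeight K (G.within U) z ∂(Measure.pi fun _ => P) = t)
    (hrefl : ∀ U₁ U₂ : T.bags, T.tree.Adj U₁ U₂ →
      ∀ g : (V₁ ⊕ V₂ → Z) → ℝ≥0∞, Measurable g → DependsOn g (U₁.1 ∩ U₂.1) →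
        ∫⁻ z, edgeWeight K (G.within U₁.1) z * g z ∂(Measure.pi fun _ => P) =
          ∫⁻ z, edgeWeight K (G.within U₂.1) z * g z ∂(Measure.pi fun _ => P))
    (hinter : ∀ U₁ U₂ : T.bags, T.tree.Adj U₁ U₂ →
      ∫⁻ z, edgeWeight K (G.within (U₁.1 ∩ U₂.1)) z ∂(Measure.pi fun _ => P) ≤ t) :
    (t : ℝ≥0∞) ≤ ∫⁻ z, edgeWeight K G.edges z ∂(Measure.pi fun _ => P) := by
  classical
  let good : Set (Finset T.bags) := {B | B.Nonempty ∧ T.PathConnected B ∧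
    Nonempty (GluedDensity P K G t (T.edgesIn B) (⋃ U ∈ B, U.1) {U | ∃ b ∈ B, b.1 = U})}
  obtain ⟨U₀⟩ := T.isTree.connected.nonempty
  have h0 : {U₀} ∈ good := by
    refine ⟨⟨U₀, by simp⟩, ?_, ?_⟩
    · intro a ha b hb
      rw [Finset.mem_singleton] at ha hb
      subst ha hb
      exact ⟨.nil, .nil, by simp⟩
    · have h := GluedDensity.single (P := P) (G := G) hK ht U₀.1
      have h1 : T.edgesIn {U₀} = G.within U₀.1 := by simp [edgesIn]
      have h2 : {U | ∃ b ∈ ({U₀} : Finset T.bags), b.1 = U} = {U₀.1} := by ext; simp [eq_comm]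
      have h3 : (⋃ U ∈ ({U₀} : Finset T.bags), U.1) = U₀.1 := by simp
      rw [h1, h2, h3]
      exact ⟨h⟩
  -- If a maximal good set missed a bag, some tree edge would leave it, and the bag at the far end
  -- could be glued on.
  obtain ⟨B, hB⟩ := (Set.toFinite good).exists_maximal ⟨_, h0⟩
  obtain ⟨⟨hne, hconn, ⟨X⟩⟩, hmax⟩ := hB
  have huniv : ∀ U, U ∈ B := by
    intro U₂
    by_contra hU₂
    obtain ⟨U₁, hU₁⟩ := hne
    obtain ⟨q⟩ := T.isTree.connected.preconnected U₁ U₂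
    obtain ⟨d, -, hd1, hd2⟩ := q.exists_boundary_dart (B : Set T.bags) hU₁ hU₂
    set U' := d.fst
    set U := d.snd
    have hadj : T.tree.Adj U' U := d.adj
    have hsub := fun U₁ (h : U₁ ∈ B) => T.inter_subset_of_adj hconn hd1 hd2 hadj h
    have hAU : (⋃ V ∈ B, V.1) ∩ U.1 ⊆ U'.1 := by
      rintro v ⟨hv, hvU⟩
      simp only [Set.mem_iUnion] at hv
      obtain ⟨V, hV, hv⟩ := hv
      exact hsub V hV ⟨hv, hvU⟩
    -- An edge in an old bag and in `U` has both ends in `U'`. Thus exactly the edges within `U' ∩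
    -- U` would be counted twice.
    have hF : T.edgesIn B ∩ G.within U.1 = G.within (U'.1 ∩ U.1) := by
      ext p
      simp only [edgesIn, Finset.mem_inter, Finset.mem_biUnion, Bigraph.mem_within]
      constructor
      · rintro ⟨⟨V, hV, hp, h1, h2⟩, -, h3, h4⟩
        exact ⟨hp, ⟨hsub V hV ⟨h1, h3⟩, h3⟩, hsub V hV ⟨h2, h4⟩, h4⟩
      · rintro ⟨hp, h1, h2⟩
        exact ⟨⟨U', hd1, hp, h1.1, h2.1⟩, hp, h1.2, h2.2⟩
    have hext := X.extend hK hC ht (U' := U'.1) (U := U.1) ⟨U', hd1, rfl⟩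
      (by rintro _ ⟨V, hV, rfl⟩; exact Set.subset_biUnion_of_mem (u := fun V : T.bags => V.1) hV)
      hAU hF (hrefl _ _ hadj) (hinter _ _ hadj)
    have hgood : insert U B ∈ good := by
      refine ⟨Finset.insert_nonempty _ _, T.pathConnected_insert hconn hd1 hd2 hadj, ?_⟩
      have h1 : T.edgesIn (insert U B) = T.edgesIn B ∪ G.within U.1 := by
        rw [edgesIn, Finset.biUnion_insert, Finset.union_comm]; rfl
      have h2 : {V | ∃ b ∈ insert U B, b.1 = V} = insert U.1 {V | ∃ b ∈ B, b.1 = V} := by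
        ext V
        simp only [Finset.mem_insert, Set.mem_ofPred_eq, Set.mem_insert_iff]
        constructor
        · rintro ⟨b, rfl | hb, rfl⟩
          · exact Or.inl rfl
          · exact Or.inr ⟨b, hb, rfl⟩
        · rintro (rfl | ⟨b, hb, rfl⟩)
          · exact ⟨U, Or.inl rfl, rfl⟩
          · exact ⟨b, Or.inr hb, rfl⟩
      have h3 : (⋃ V ∈ insert U B, V.1) = (⋃ V ∈ B, V.1) ∪ U.1 := by
        rw [Finset.set_biUnion_insert, Set.union_comm]
      rw [h1, h2, h3]
      exact hext
    exact hd2 (hmax hgood (Finset.subset_insert _ _) (Finset.mem_insert_self _ _))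
  have hall : T.edgesIn B = G.edges := by
    ext p
    simp only [edgesIn, Finset.mem_biUnion, Bigraph.mem_within]
    constructor
    · rintro ⟨_, _, hp, _⟩
      exact hp
    · intro hp
      obtain ⟨U, hU, h⟩ := T.cover_edges p hp
      exact ⟨⟨U, hU⟩, huniv _, hp, h⟩
  rw [← hall]
  exact X.le_lintegral hK ht ⟨U₀, huniv _, rfl⟩ (hbag _ U₀.2)

end ReflectiveTreeDecomposition
end TreeGrowth

/-! ### Integrating out vertices of degree at most 1. -/

section Pruning

variable {V₁ : Type u₁} {V₂ : Type u₂} {Z : Type*} [MeasurableSpace Z]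
  {P : Measure Z} [IsProbabilityMeasure P] {K : Z → Z → ℝ≥0}

theorem Bigraph.graph_adj_inl_inr (G : Bigraph V₁ V₂) (v : V₁) (w : V₂) :
    G.graph.Adj (Sum.inl v) (Sum.inr w) ↔ (v, w) ∈ G.edges := by
  simp [graph]

theorem Bigraph.graph_adj_inr_inl (G : Bigraph V₁ V₂) (v : V₁) (w : V₂) :
    G.graph.Adj (Sum.inr w) (Sum.inl v) ↔ (v, w) ∈ G.edges := by
  simp [graph]

theorem Bigraph.not_graph_adj_inl (G : Bigraph V₁ V₂) (v v' : V₁) :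
    ¬ G.graph.Adj (Sum.inl v) (Sum.inl v') := by
  simp [graph]

theorem Bigraph.not_graph_adj_inr (G : Bigraph V₁ V₂) (w w' : V₂) :
    ¬ G.graph.Adj (Sum.inr w) (Sum.inr w') := by
  simp [graph]

/-- Almost all the marginals of the kernel `K` are equal to `1`. -/
structure IsDoublyStochastic (P : Measure Z) (K : Z → Z → ℝ≥0) : Prop where
  left : ∀ᵐ x ∂P, ∫⁻ y, K x y ∂P = 1
  right : ∀ᵐ y ∂P, ∫⁻ x, K x y ∂P = 1

variable [Fintype V₁] [Fintype V₂] {G : Bigraph V₁ V₂}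

omit [IsProbabilityMeasure P] in
theorem integrateOut_singleton [SigmaFinite P] {V : Type*} [Fintype V] (v : V) (u : (V → Z) → ℝ≥0∞) (z : V → Z) :
    integrateOut P {v} u z =
      ∫⁻ x, u (@Function.update V (fun _ => Z) (Classical.decEq V) z v x) ∂P := by
  let := Classical.decEq V
  have h : (Set.toFinite {v}).toFinset = ({v} : Finset V) := by ext; simp
  have h2 : integrateOut P {v} u = ∫⋯∫⁻_(Set.toFinite {v}).toFinset, u ∂fun _ => P := rfl
  rw [h2, h, lmarginal_singleton]

/-- A single factor `K (z v) (z u)` may be dropped from an integral in which `v` does not occur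
otherwise. -/
theorem lintegral_mul_kernel {V : Type*} [Fintype V] (hK : Measurable (Function.uncurry K))
    {a b : V} (hab : a ≠ b) {v : V} (hv : v = a ∨ v = b) (hP : IsDoublyStochastic P K)
    {g : (V → Z) → ℝ≥0∞} (hg : Measurable g) (hgv : DependsOn g {v}ᶜ) :
    ∫⁻ z, g z * K (z a) (z b) ∂(Measure.pi fun _ => P) = ∫⁻ z, g z ∂(Measure.pi fun _ => P) := by
  have hm : Measurable fun z : V → Z => (K (z a) (z b) : ℝ≥0∞) :=
    (hK.comp (f := fun z : V → Z => (z a, z b)) (by fun_prop)).coe_nnreal_ennreal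
  rw [lintegral_mul_integrateOut hgv (D := {v}) disjoint_compl_left hg hm]
  refine lintegral_congr_ae ?_
  have hae : ∀ᵐ z ∂(Measure.pi fun _ : V => P),
      integrateOut P {v} (fun z => (K (z a) (z b) : ℝ≥0∞)) z = 1 := by
    rcases hv with rfl | rfl
    · have h := (Measure.tendsto_eval_ae_ae (μ := fun _ : V => P) (i := b)).eventually hP.right
      filter_upwards [h] with z hz
      rw [integrateOut_singleton]
      simpa [Function.update, hab.symm] using hz
    · have h := (Measure.tendsto_eval_ae_ae (μ := fun _ : V => P) (i := a)).eventually hP.left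
      filter_upwards [h] with z hz
      rw [integrateOut_singleton]
      simpa [Function.update, hab] using hz
  filter_upwards [hae] with z hz
  rw [hz, mul_one]

/-- Removal of a vertex of degree at most `1` on which `g` does not depend. -/
theorem lintegral_edgeWeight_sdiff_singleton (hK : Measurable (Function.uncurry K))
    (hP : IsDoublyStochastic P K) {U : Set (V₁ ⊕ V₂)} {v : V₁ ⊕ V₂}
    (hdeg : {u | u ∈ U ∧ G.graph.Adj v u}.ncard < 2)
    {g : (V₁ ⊕ V₂ → Z) → ℝ≥0∞} (hg : Measurable g) (hgv : DependsOn g {v}ᶜ) :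
    ∫⁻ z, edgeWeight K (G.within U) z * g z ∂(Measure.pi fun _ => P) =
      ∫⁻ z, edgeWeight K (G.within (U \ {v})) z * g z ∂(Measure.pi fun _ => P) := by
  classical
  have hsub : G.within (U \ {v}) ⊆ G.within U := G.within_mono Set.sdiff_subset
  set I := G.within U \ G.within (U \ {v}) with hI
  have hprod : ∀ z : V₁ ⊕ V₂ → Z, edgeWeight K (G.within U) z =
      edgeWeight K I z * edgeWeight K (G.within (U \ {v})) z := fun z =>
    (Finset.prod_sdiff hsub).symm
  have hinc : ∀ p ∈ I, p ∈ G.edges ∧ Sum.inl p.1 ∈ U ∧ Sum.inr p.2 ∈ U ∧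
      (v = Sum.inl p.1 ∨ v = Sum.inr p.2) := by
    intro p hp
    simp only [hI, Finset.mem_sdiff, Bigraph.mem_within, Set.mem_sdiff, Set.mem_singleton_iff] at hp
    grind
  -- `I` consists of the edges of `U` at `v`; two of them would give `v` two distinct neighbours.
  have hcard : I.card ≤ 1 := by
    by_contra! h
    obtain ⟨p, hp, q, hq, hpq⟩ := Finset.one_lt_card.1 h
    obtain ⟨hpE, hp1, hp2, hpv⟩ := hinc p hp
    obtain ⟨hqE, hq1, hq2, hqv⟩ := hinc q hq
    have : ∃ a b, a ≠ b ∧ a ∈ {u | u ∈ U ∧ G.graph.Adj v u} ∧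
        b ∈ {u | u ∈ U ∧ G.graph.Adj v u} := by
      rcases hpv with rfl | rfl
      · have hq' : q.1 = p.1 := by simpa [eq_comm] using hqv
        refine ⟨Sum.inr p.2, Sum.inr q.2, ?_, ⟨hp2, (G.graph_adj_inl_inr _ _).2 hpE⟩, hq2, ?_⟩
        · exact fun h => hpq (Prod.ext hq'.symm (Sum.inr.inj h))
        · rw [← hq']; exact (G.graph_adj_inl_inr _ _).2 hqE
      · have hq' : q.2 = p.2 := by simpa [eq_comm] using hqv
        refine ⟨Sum.inl p.1, Sum.inl q.1, ?_, ⟨hp1, (G.graph_adj_inr_inl _ _).2 hpE⟩, hq1, ?_⟩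
        · exact fun h => hpq (Prod.ext (Sum.inl.inj h) hq'.symm)
        · rw [← hq']; exact (G.graph_adj_inr_inl _ _).2 hqE
    obtain ⟨a, b, hab, ha, hb⟩ := this
    exact absurd ((Set.one_lt_ncard (Set.toFinite _)).2 ⟨a, ha, b, hb, hab⟩) (by omega)
  set w' := fun z => (edgeWeight K (G.within (U \ {v})) z : ℝ≥0∞) * g z with hw'
  have hwm : Measurable w' := (measurable_edgeWeight hK _).coe_nnreal_ennreal.mul hg
  have hwv : DependsOn w' {v}ᶜ := DependsOn.comp₂ (fun (a : ℝ≥0) (b : ℝ≥0∞) => a * b)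
    ((dependsOn_edgeWeight K G _).mono_of_subset fun _ h => h.2) hgv
  have heq : ∀ z, (edgeWeight K (G.within U) z : ℝ≥0∞) * g z = w' z * edgeWeight K I z := by
    intro z
    rw [hprod, hw']
    push_cast
    ring
  simp only [heq]
  rcases I.eq_empty_or_nonempty with h0 | ⟨p, hp⟩
  · simp [h0, edgeWeight]
  · have hIp : I = {p} := by
      refine Finset.eq_singleton_iff_unique_mem.2 ⟨hp, fun q hq => ?_⟩
      exact Finset.card_le_one.1 hcard q hq p hp
    simp only [hIp, edgeWeight, Finset.prod_singleton]
    exact lintegral_mul_kernel hK (by simp) (hinc p hp).2.2.2 hP hwm hwv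

/-- If `C` is the largest vertex set between `R` and `U` in which all vertices outside `R` have
degree at least `2`, then the weights of `U` and `C` have the same marginals on `R`. -/
theorem lintegral_edgeWeight_core (hK : Measurable (Function.uncurry K))
    (hP : IsDoublyStochastic P K) {R C U : Set (V₁ ⊕ V₂)} (hCU : C ⊆ U) (hC : G.IsTwoDense R C)
    (hmax : ∀ D ⊆ U, G.IsTwoDense R D → D ⊆ C)
    {g : (V₁ ⊕ V₂ → Z) → ℝ≥0∞} (hg : Measurable g) (hgR : DependsOn g R) :
    ∫⁻ z, edgeWeight K (G.within U) z * g z ∂(Measure.pi fun _ => P) =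
      ∫⁻ z, edgeWeight K (G.within C) z * g z ∂(Measure.pi fun _ => P) := by
  induction h : U.ncard using Nat.strong_induction_on generalizing U with
  | _ n ih =>
  subst h
  by_cases hU : G.IsTwoDense R U
  · rw [hCU.antisymm (hmax U subset_rfl hU)]
  · have : ∃ v ∈ U, v ∉ R ∧ {u | u ∈ U ∧ G.graph.Adj v u}.ncard < 2 := by
      by_contra! hcon
      exact hU ⟨hC.1.trans hCU, hcon⟩
    obtain ⟨v, hvU, hvR, hdeg⟩ := this
    -- Degrees in `C` are at most those in `U`, so pruning `v` never touches the core.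
    have hvC : v ∉ C := fun hvC => by
      have h1 := hC.2 v hvC hvR
      have h2 : {u | u ∈ C ∧ G.graph.Adj v u}.ncard ≤ {u | u ∈ U ∧ G.graph.Adj v u}.ncard :=
        Set.ncard_le_ncard (fun u hu => ⟨hCU hu.1, hu.2⟩) (Set.toFinite _)
      omega
    rw [lintegral_edgeWeight_sdiff_singleton hK hP hdeg hg
      (hgR.mono_of_subset fun u hu huv => hvR (huv ▸ hu))]
    have hlt : (U \ {v}).ncard < U.ncard :=
      Set.ncard_lt_ncard ⟨Set.sdiff_subset, fun h => (h hvU).2 rfl⟩ (Set.toFinite _)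
    have hCv : C ⊆ U \ {v} := fun u hu =>
      ⟨hCU hu, fun h => hvC ((Set.mem_singleton_iff.1 h) ▸ hu)⟩
    exact ih _ hlt hCv (fun D hD => hmax D (hD.trans Set.sdiff_subset)) rfl

end Pruning

/-! ### Transport of weights along injections of vertices. -/

section Embedding

variable {Z : Type*} [MeasurableSpace Z] {P : Measure Z} [IsProbabilityMeasure P]

/-- The preimage of a box is a box whose additional factors are the whole space, and these have
measure 1. -/
theorem measurePreserving_comp_injective {V V' : Type*} [Fintype V] [Fintype V'] {ι : V' → V}
    (hι : Function.Injective ι) :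
    MeasurePreserving (fun z : V → Z => z ∘ ι) (Measure.pi fun _ => P) (Measure.pi fun _ => P) := by
  have hm : Measurable fun z : V → Z => z ∘ ι :=
    measurable_pi_lambda _ fun i => measurable_pi_apply (ι i)
  refine ⟨hm, (Measure.pi_eq fun s hs => ?_).symm⟩
  rw [Measure.map_apply hm (MeasurableSet.univ_pi hs)]
  have h : (fun z : V → Z => z ∘ ι) ⁻¹' Set.univ.pi s =
      Set.univ.pi (Function.extend ι s fun _ => Set.univ) := by
    ext z
    simp only [Set.mem_preimage, Set.mem_pi, Set.mem_univ, true_imp_iff, Function.comp]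
    constructor
    · intro h v
      by_cases hv : ∃ c, ι c = v
      · obtain ⟨c, rfl⟩ := hv
        rw [hι.extend_apply]; exact h c
      · rw [Function.extend_apply' _ _ _ hv]; trivial
    · intro h c
      have := h (ι c)
      rwa [hι.extend_apply] at this
  rw [h, Measure.pi_pi]
  refine (Fintype.prod_of_injective ι hι _ _ (fun v hv => ?_) fun c => ?_).symm
  · rw [Function.extend_apply' _ _ _ hv]; simp
  · rw [hι.extend_apply]

omit [MeasurableSpace Z] in
theorem edgeWeight_eq_comp {V₁ V₂ V₁' V₂' : Type*} {a : V₁' → V₁} {b : V₂' → V₂}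
    (ha : Function.Injective a) (hb : Function.Injective b) {F : Finset (V₁ × V₂)}
    {F' : Finset (V₁' × V₂')} (hF : ∀ p, p ∈ F ↔ ∃ q ∈ F', (a q.1, b q.2) = p) (K : Z → Z → ℝ≥0)
    (z : V₁ ⊕ V₂ → Z) : edgeWeight K F z = edgeWeight K F' (z ∘ Sum.map a b) := by
  have h : F = F'.map ⟨fun q => (a q.1, b q.2), fun q q' h =>
      Prod.ext (ha (Prod.ext_iff.1 h).1) (hb (Prod.ext_iff.1 h).2)⟩ := by
    ext p
    rw [hF, Finset.mem_map]
    rfl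
  rw [h, edgeWeight, Finset.prod_map]
  rfl

end Embedding

/-! ### Cores of induced subgraphs and the marginals of bags. -/

section Induced

variable {V₁ : Type u₁} {V₂ : Type u₂}

namespace Bigraph

/-- The inclusion of the vertices of an induced subgraph. -/
def inducedVal (U : Set (V₁ ⊕ V₂)) : Left U ⊕ Right U → V₁ ⊕ V₂ :=
  Sum.map Subtype.val Subtype.val

theorem inducedVal_injective (U : Set (V₁ ⊕ V₂)) : Function.Injective (inducedVal U) :=
  Subtype.val_injective.sumMap Subtype.val_injective

theorem inducedVal_mem (U : Set (V₁ ⊕ V₂)) (x : Left U ⊕ Right U) : inducedVal U x ∈ U := by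
  rcases x with ⟨v, hv⟩ | ⟨v, hv⟩ <;> exact hv

theorem inducedVal_toInduced (U : Set (V₁ ⊕ V₂)) (v : V₁ ⊕ V₂) (hv : v ∈ U) :
    inducedVal U (toInduced U v hv) = v := by
  cases v <;> rfl

theorem image_preimage_inducedVal {U D : Set (V₁ ⊕ V₂)} (h : D ⊆ U) :
    inducedVal U '' (inducedVal U ⁻¹' D) = D :=
  Set.image_preimage_eq_of_subset fun v hv => ⟨toInduced U v (h hv), inducedVal_toInduced _ _ _⟩

variable [Finite V₁] [Finite V₂] (G : Bigraph V₁ V₂)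

theorem mem_edges_induce {U : Set (V₁ ⊕ V₂)} (p : Left U × Right U) :
    p ∈ (G.induce U).edges ↔ (p.1.1, p.2.1) ∈ G.edges := by
  simp [induce]

theorem induce_graph_adj {U : Set (V₁ ⊕ V₂)} (x y : Left U ⊕ Right U) :
    (G.induce U).graph.Adj x y ↔ G.graph.Adj (inducedVal U x) (inducedVal U y) := by
  rcases x with x | x <;> rcases y with y | y <;>
    simp [inducedVal, graph_adj_inl_inr, graph_adj_inr_inl, not_graph_adj_inl, not_graph_adj_inr,
      mem_edges_induce]

/-- Pruning takes place inside `G`, whereas the core of a flag lives on the subtype of its bag. This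
lets density and maximality pass between the two. -/
theorem isTwoDense_image {U : Set (V₁ ⊕ V₂)} (R S : Set (Left U ⊕ Right U)) :
    G.IsTwoDense (inducedVal U '' R) (inducedVal U '' S) ↔ (G.induce U).IsTwoDense R S := by
  have hinj := inducedVal_injective U
  have hdeg : ∀ x, {u | u ∈ inducedVal U '' S ∧ G.graph.Adj (inducedVal U x) u}.ncard =
      {u | u ∈ S ∧ (G.induce U).graph.Adj x u}.ncard := by
    intro x
    rw [← Set.ncard_image_of_injective _ hinj]
    congr 1
    ext u
    constructor
    · rintro ⟨⟨y, hy, rfl⟩, h⟩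
      exact ⟨y, ⟨hy, (G.induce_graph_adj _ _).2 h⟩, rfl⟩
    · rintro ⟨y, ⟨hy, h⟩, rfl⟩
      exact ⟨⟨y, hy, rfl⟩, (G.induce_graph_adj _ _).1 h⟩
  unfold IsTwoDense
  rw [Set.image_subset_image_iff hinj, Set.forall_mem_image]
  simp only [hinj.mem_set_image, hdeg]

end Bigraph

variable {Z : Type*} [MeasurableSpace Z] {P : Measure Z} [IsProbabilityMeasure P] {K : Z → Z → ℝ≥0}
  [Fintype V₁] [Fintype V₂] {G : Bigraph V₁ V₂}

omit [MeasurableSpace Z] in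
theorem edgeWeight_within (U : Set (V₁ ⊕ V₂)) (z : V₁ ⊕ V₂ → Z) :
    edgeWeight K (G.within U) z = edgeWeight K (G.induce U).edges (z ∘ Bigraph.inducedVal U) := by
  refine edgeWeight_eq_comp Subtype.val_injective Subtype.val_injective (fun p => ?_) K z
  rw [Bigraph.mem_within]
  constructor
  · rintro ⟨hp, h1, h2⟩
    exact ⟨(⟨p.1, h1⟩, ⟨p.2, h2⟩), (G.mem_edges_induce _).2 hp, rfl⟩
  · rintro ⟨q, hq, rfl⟩
    exact ⟨(G.mem_edges_induce _).1 hq, q.1.2, q.2.2⟩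

omit [MeasurableSpace Z] in
theorem edgeWeight_within_image {U : Set (V₁ ⊕ V₂)}
    (A : Set (Bigraph.Left U ⊕ Bigraph.Right U)) (z : V₁ ⊕ V₂ → Z) :
    edgeWeight K (G.within (Bigraph.inducedVal U '' A)) z =
      edgeWeight K ((G.induce U).induce A).edges
        (z ∘ Bigraph.inducedVal U ∘ Bigraph.inducedVal A) := by
  have h : edgeWeight K (G.within (Bigraph.inducedVal U '' A)) z =
      edgeWeight K ((G.induce U).within A) (z ∘ Bigraph.inducedVal U) := by
    refine edgeWeight_eq_comp Subtype.val_injective Subtype.val_injective (fun p => ?_) K z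
    rw [Bigraph.mem_within]
    constructor
    · rintro ⟨hp, ⟨x, hx, h1⟩, ⟨y, hy, h2⟩⟩
      rcases x with x | x <;> rcases y with y | y <;>
        simp only [Bigraph.inducedVal, Sum.map_inl, Sum.map_inr, Sum.inl.injEq, Sum.inr.injEq,
          reduceCtorEq] at h1 h2
      refine ⟨(x, y), Bigraph.mem_within.2 ⟨(G.mem_edges_induce _).2 ?_, hx, hy⟩, ?_⟩ <;>
        simp [h1, h2, hp]
    · rintro ⟨q, hq, rfl⟩
      rw [Bigraph.mem_within] at hq
      exact ⟨(G.mem_edges_induce _).1 hq.1, ⟨_, hq.2.1, rfl⟩, ⟨_, hq.2.2, rfl⟩⟩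
  rw [h, edgeWeight_within]
  rfl

theorem lintegral_edgeWeight_coreVerts (hK : Measurable (Function.uncurry K))
    (hP : IsDoublyStochastic P K) {U : Set (V₁ ⊕ V₂)}
    (R : Set (Bigraph.Left U ⊕ Bigraph.Right U))
    {g : (V₁ ⊕ V₂ → Z) → ℝ≥0∞} (hg : Measurable g)
    (hgR : DependsOn g (Bigraph.inducedVal U '' R)) :
    ∫⁻ z, edgeWeight K (G.within U) z * g z ∂(Measure.pi fun _ => P) =
      ∫⁻ z, edgeWeight K ((G.induce U).induce ((G.induce U).coreVerts R)).edges
        (z ∘ Bigraph.inducedVal U ∘ Bigraph.inducedVal ((G.induce U).coreVerts R)) * g z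
        ∂(Measure.pi fun _ => P) := by
  have hgr := (G.induce U).isGreatest_coreVerts R
  simp only [← edgeWeight_within_image]
  refine lintegral_edgeWeight_core hK hP ?_ ((G.isTwoDense_image _ _).2 hgr.1) ?_ hg hgR
  · rintro _ ⟨x, -, rfl⟩
    exact Bigraph.inducedVal_mem U x
  · intro D hD hdense
    rw [← Bigraph.image_preimage_inducedVal hD] at hdense ⊢
    exact Set.image_mono (hgr.2 ((G.isTwoDense_image _ _).1 hdense))

/-- Bags whose flags have isomorphic `2`-cores have the same marginals on their intersection. -/
theorem lintegral_edgeWeight_of_isIsomorphic (hK : Measurable (Function.uncurry K))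
    (hP : IsDoublyStochastic P K) {U₁ U₂ S : Set (V₁ ⊕ V₂)} (h₁ : S ⊆ U₁) (h₂ : S ⊆ U₂)
    (hiso : (BigraphFlag.ofInduced G U₁ S h₁).twoCore.IsIsomorphic
      (BigraphFlag.ofInduced G U₂ S h₂).twoCore)
    {g : (V₁ ⊕ V₂ → Z) → ℝ≥0∞} (hg : Measurable g) (hgS : DependsOn g S) :
    ∫⁻ z, edgeWeight K (G.within U₁) z * g z ∂(Measure.pi fun _ => P) =
      ∫⁻ z, edgeWeight K (G.within U₂) z * g z ∂(Measure.pi fun _ => P) := by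
  classical
  obtain ⟨z₀⟩ : Nonempty Z := nonempty_of_isProbabilityMeasure P
  have hR : ∀ (U : Set (V₁ ⊕ V₂)) (h : S ⊆ U),
      DependsOn g (Bigraph.inducedVal U '' Set.range (BigraphFlag.ofInduced G U S h).label) := by
    intro U h
    refine hgS.mono_of_subset fun v hv => ?_
    exact ⟨_, ⟨⟨v, hv⟩, rfl⟩, Bigraph.inducedVal_toInduced U v (h hv)⟩
  set F₁ := BigraphFlag.ofInduced G U₁ S h₁
  set F₂ := BigraphFlag.ofInduced G U₂ S h₂
  obtain ⟨f, hf⟩ := hiso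
  rw [lintegral_edgeWeight_coreVerts hK hP _ hg (hR U₁ h₁),
    lintegral_edgeWeight_coreVerts hK hP _ hg (hR U₂ h₂)]
  set ι₁ := Bigraph.inducedVal U₁ ∘ Bigraph.inducedVal F₁.coreVerts
  set ι₂ := Bigraph.inducedVal U₂ ∘ Bigraph.inducedVal F₂.coreVerts
  have hι₁ : Function.Injective ι₁ :=
    (Bigraph.inducedVal_injective _).comp (Bigraph.inducedVal_injective _)
  have hι₂ : Function.Injective (ι₂ ∘ f.onVerts) :=
    ((Bigraph.inducedVal_injective _).comp (Bigraph.inducedVal_injective _)).comp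
      f.onVerts.injective
  have hl₁ : ∀ v : S, ι₁ (F₁.twoCore.label v) = v := fun v =>
    (congrArg _ (Bigraph.inducedVal_toInduced _ _ _)).trans (Bigraph.inducedVal_toInduced _ _ _)
  have hl₂ : ∀ v : S, ι₂ (f.onVerts (F₁.twoCore.label v)) = v := fun v => by
    rw [hf]
    exact (congrArg _ (Bigraph.inducedVal_toInduced _ _ _)).trans
      (Bigraph.inducedVal_toInduced _ _ _)
  -- `g` is read off from the labelled vertices of the core; the default `z₀` elsewhere is
  -- irrelevant, as `g` depends on `S` only. Both integrals then become the same integral over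
  -- configurations of the first core.
  let ext : (Bigraph.Left F₁.coreVerts ⊕ Bigraph.Right F₁.coreVerts → Z) → V₁ ⊕ V₂ → Z :=
    fun y v => if h : v ∈ S then y (F₁.twoCore.label ⟨v, h⟩) else z₀
  have hext : Measurable ext := by
    refine measurable_pi_lambda _ fun v => ?_
    by_cases h : v ∈ S
    · simpa [ext, h] using measurable_pi_apply _
    · simp [ext, h]
  let φ := fun y => (edgeWeight K F₁.twoCore.toBigraph.edges y : ℝ≥0∞) * g (ext y)
  have hφ : Measurable φ := (measurable_edgeWeight hK _).coe_nnreal_ennreal.mul (hg.comp hext)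
  have e₁ : ∀ z : V₁ ⊕ V₂ → Z, (edgeWeight K F₁.twoCore.toBigraph.edges (z ∘ ι₁) : ℝ≥0∞) * g z =
      φ (z ∘ ι₁) := by
    intro z
    have : g z = g (ext (z ∘ ι₁)) := hgS fun v hv => by simp [ext, hv, hl₁]
    rw [this]
  have e₂ : ∀ z : V₁ ⊕ V₂ → Z, (edgeWeight K F₂.twoCore.toBigraph.edges (z ∘ ι₂) : ℝ≥0∞) * g z =
      φ (z ∘ (ι₂ ∘ f.onVerts)) := by
    intro z
    have h1 : g z = g (ext (z ∘ (ι₂ ∘ f.onVerts))) := hgS fun v hv => by simp [ext, hv, hl₂]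
    have h2 : edgeWeight K F₂.twoCore.toBigraph.edges (z ∘ ι₂) =
        edgeWeight K F₁.twoCore.toBigraph.edges (z ∘ ι₂ ∘ f.onVerts) := by
      refine edgeWeight_eq_comp f.left.injective f.right.injective (fun p => ?_) K (z ∘ ι₂)
      constructor
      · intro hp
        exact ⟨(f.left.symm p.1, f.right.symm p.2), (f.edge_iff _ _).2 (by simpa using hp),
          by simp⟩
      · rintro ⟨q, hq, rfl⟩
        exact (f.edge_iff _ _).1 hq
    rw [h1, h2]
  calc _ = ∫⁻ z, φ (z ∘ ι₁) ∂(Measure.pi fun _ : V₁ ⊕ V₂ => P) := lintegral_congr e₁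
    _ = ∫⁻ y, φ y ∂(Measure.pi fun _ => P) :=
      (measurePreserving_comp_injective hι₁).lintegral_comp hφ
    _ = ∫⁻ z, φ (z ∘ (ι₂ ∘ f.onVerts)) ∂(Measure.pi fun _ : V₁ ⊕ V₂ => P) :=
      ((measurePreserving_comp_injective hι₂).lintegral_comp hφ).symm
    _ = _ := (lintegral_congr e₂).symm

/-- The weight of a bigraph does not change when it is embedded into a larger one. -/
theorem lintegral_edgeWeight_within (hK : Measurable (Function.uncurry K)) (U : Set (V₁ ⊕ V₂)) :
    ∫⁻ z, edgeWeight K (G.within U) z ∂(Measure.pi fun _ => P) =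
      ∫⁻ z, edgeWeight K (G.induce U).edges z ∂(Measure.pi fun _ => P) := by
  simp only [edgeWeight_within]
  exact (measurePreserving_comp_injective (Bigraph.inducedVal_injective U)).lintegral_comp
    (measurable_edgeWeight hK _).coe_nnreal_ennreal

/-- Pruning with no labelled vertices, tested against the constant 1, reduces a bag to its
unlabelled 2-core. -/
theorem lintegral_edgeWeight_of_iso {H₁ H₂ : Type*} [Fintype H₁] [Fintype H₂]
    {H : Bigraph H₁ H₂} (hK : Measurable (Function.uncurry K)) (hP : IsDoublyStochastic P K)
    {U : Set (V₁ ⊕ V₂)} (f : H.Iso (G.induce U).twoCore) :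
    ∫⁻ z, edgeWeight K H.edges z ∂(Measure.pi fun _ => P) =
      ∫⁻ z, edgeWeight K (G.within U) z ∂(Measure.pi fun _ => P) := by
  have h := lintegral_edgeWeight_coreVerts (G := G) (U := U) hK hP ∅ (g := fun _ => 1)
    measurable_const fun _ _ _ => rfl
  simp only [mul_one] at h
  have h2 : ∀ z : V₁ ⊕ V₂ → Z, edgeWeight K (G.induce U).twoCore.edges
      (z ∘ Bigraph.inducedVal U ∘ Bigraph.inducedVal ((G.induce U).coreVerts ∅)) =
      edgeWeight K H.edges (z ∘ (Bigraph.inducedVal U ∘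
        Bigraph.inducedVal ((G.induce U).coreVerts ∅) ∘ f.onVerts)) := by
    intro z
    refine edgeWeight_eq_comp f.left.injective f.right.injective (fun p => ?_) K _
    constructor
    · intro hp
      exact ⟨(f.left.symm p.1, f.right.symm p.2), (f.edge_iff _ _).2 (by simpa using hp),
        by simp⟩
    · rintro ⟨q, hq, rfl⟩
      exact (f.edge_iff _ _).1 hq
  rw [h]
  symm
  calc _ = _ := lintegral_congr fun z => congrArg _ (h2 z)
    _ = _ := (measurePreserving_comp_injective ((Bigraph.inducedVal_injective _).comp
      ((Bigraph.inducedVal_injective _).comp f.onVerts.injective))).lintegral_comp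
        (measurable_edgeWeight hK _).coe_nnreal_ennreal

end Induced

/-! ### From bigraphons to kernels on one space. -/

section Density

variable {V₁ : Type u₁} {V₂ : Type u₂} [Fintype V₁] [Fintype V₂] {X Y : Type w}
  [MeasurableSpace X] [MeasurableSpace Y] {μ : Measure X} {ν : Measure Y}
  [IsProbabilityMeasure μ] [IsProbabilityMeasure ν] {W : X × Y → ℝ}

omit [Fintype V₁] [Fintype V₂] in
theorem IsBigraphon.measurable_prod (hW : IsBigraphon W) (F : Finset (V₁ × V₂)) :
    Measurable fun z : (V₁ → X) × (V₂ → Y) => ∏ p ∈ F, W (z.1 p.1, z.2 p.2) :=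
  Finset.measurable_fun_prod _ fun p _ =>
    hW.measurable.comp (f := fun z : (V₁ → X) × (V₂ → Y) => (z.1 p.1, z.2 p.2)) (by fun_prop)

omit [Fintype V₁] [Fintype V₂] in
theorem IsBigraphon.integrable_prod (hW : IsBigraphon W) (F : Finset (V₁ × V₂))
    (m : Measure ((V₁ → X) × (V₂ → Y))) [IsFiniteMeasure m] :
    Integrable (fun z => ∏ p ∈ F, W (z.1 p.1, z.2 p.2)) m := by
  obtain ⟨C, hC⟩ := hW.bounded
  refine Integrable.of_bound (hW.measurable_prod F).aestronglyMeasurable (C ^ F.card)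
    (Filter.Eventually.of_forall fun z => ?_)
  rw [Real.norm_of_nonneg (Finset.prod_nonneg fun p _ => hW.nonneg _)]
  exact (Finset.prod_le_prod (fun p _ => hW.nonneg _) fun p _ => hC _).trans (by simp)

theorem IsBigraphon.integrable (hW : IsBigraphon W) (m : Measure (X × Y)) [IsFiniteMeasure m] :
    Integrable W m := by
  obtain ⟨C, hC⟩ := hW.bounded
  refine Integrable.of_bound hW.measurable.aestronglyMeasurable C
    (Filter.Eventually.of_forall fun z => ?_)
  rw [Real.norm_of_nonneg (hW.nonneg _)]
  exact hC z

theorem IsBigraphon.integrable_left (hW : IsBigraphon W) (x : X) :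
    Integrable (fun y => W (x, y)) ν := by
  obtain ⟨C, hC⟩ := hW.bounded
  refine Integrable.of_bound
    (hW.measurable.comp measurable_prodMk_left).aestronglyMeasurable C
    (Filter.Eventually.of_forall fun z => ?_)
  rw [Real.norm_of_nonneg (hW.nonneg _)]
  exact hC _

theorem IsBigraphon.integrable_right (hW : IsBigraphon W) (y : Y) :
    Integrable (fun x => W (x, y)) μ := by
  obtain ⟨C, hC⟩ := hW.bounded
  refine Integrable.of_bound
    (hW.measurable.comp measurable_prodMk_right).aestronglyMeasurable C
    (Filter.Eventually.of_forall fun z => ?_)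
  rw [Real.norm_of_nonneg (hW.nonneg _)]
  exact hC _

omit [IsProbabilityMeasure μ] [IsProbabilityMeasure ν] in
theorem IsBigraphon.density_nonneg (hW : IsBigraphon W) (G : Bigraph V₁ V₂) :
    0 ≤ G.density μ ν W :=
  integral_nonneg fun _ => Finset.prod_nonneg fun _ _ => hW.nonneg _

theorem rho_density (W : X × Y → ℝ) (hW : Measurable W) :
    Bigraph.rho.density μ ν W = ∫ z, W z ∂(μ.prod ν) := by
  have h := (measurePreserving_eval (fun _ : Unit => μ) ()).prod
    (measurePreserving_eval (fun _ : Unit => ν) ())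
  rw [← h.map_eq, integral_map h.measurable.aemeasurable hW.aestronglyMeasurable]
  refine integral_congr_ae (Filter.Eventually.of_forall fun z => ?_)
  simp [Bigraph.rho, Fintype.prod_prod_type]
  rfl

theorem IsBigraphon.rho_density_pos (hW : IsBigraphon W) (h0 : ¬ W =ᵐ[μ.prod ν] 0) :
    0 < Bigraph.rho.density μ ν W := by
  refine (hW.density_nonneg _).lt_of_ne fun h => h0 ?_
  rw [rho_density W hW.measurable, eq_comm,
    integral_eq_zero_iff_of_nonneg hW.nonneg (hW.integrable _)] at h
  exact h

/-- The kernel on the product of the two vertex spaces that is given by `W / c`. -/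
noncomputable def productKernel (W : X × Y → ℝ) (c : ℝ) (z z' : X × Y) : ℝ≥0 :=
  (W (z.1, z'.2) / c).toNNReal

theorem measurable_productKernel (hW : IsBigraphon W) (c : ℝ) :
    Measurable (Function.uncurry (productKernel W c)) :=
  ((hW.measurable.comp (f := fun p : (X × Y) × (X × Y) => (p.1.1, p.2.2))
    (by fun_prop)).div_const c).real_toNNReal

theorem productKernel_bounded (hW : IsBigraphon W) {c : ℝ} (hc : 0 < c) :
    ∃ C, ∀ z z', productKernel W c z z' ≤ C := by
  obtain ⟨C, hC⟩ := hW.bounded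
  exact ⟨(C / c).toNNReal, fun z z' => Real.toNNReal_le_toNNReal (by gcongr; exact hC _)⟩

theorem isDoublyStochastic_productKernel (hW : IsBigraphon W) (hb : IsBiregular μ ν W)
    (hpos : 0 < Bigraph.rho.density μ ν W) :
    IsDoublyStochastic (μ.prod ν) (productKernel W (Bigraph.rho.density μ ν W)) := by
  set d := Bigraph.rho.density μ ν W
  constructor
  · have h := (measurePreserving_fst (μ := μ) (ν := ν)).quasiMeasurePreserving.ae hb.1
    filter_upwards [h] with x hx
    have hm : Measurable fun y => ENNReal.ofReal (W (x.1, y) / d) :=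
      ((hW.measurable.comp measurable_prodMk_left).div_const d).ennreal_ofReal
    calc _ = ∫⁻ y, ENNReal.ofReal (W (x.1, y) / d) ∂ν :=
          (measurePreserving_snd (μ := μ) (ν := ν)).lintegral_comp hm
      _ = ENNReal.ofReal (∫ y, W (x.1, y) / d ∂ν) :=
          (ofReal_integral_eq_lintegral_ofReal ((hW.integrable_left _).div_const d)
            (Filter.Eventually.of_forall fun y => div_nonneg (hW.nonneg _) hpos.le)).symm
      _ = 1 := by rw [integral_div, hx, div_self hpos.ne', ENNReal.ofReal_one]
  · have h := (measurePreserving_snd (μ := μ) (ν := ν)).quasiMeasurePreserving.ae hb.2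
    filter_upwards [h] with y hy
    have hm : Measurable fun x => ENNReal.ofReal (W (x, y.2) / d) :=
      ((hW.measurable.comp measurable_prodMk_right).div_const d).ennreal_ofReal
    calc _ = ∫⁻ x, ENNReal.ofReal (W (x, y.2) / d) ∂μ :=
          (measurePreserving_fst (μ := μ) (ν := ν)).lintegral_comp hm
      _ = ENNReal.ofReal (∫ x, W (x, y.2) / d ∂μ) :=
          (ofReal_integral_eq_lintegral_ofReal ((hW.integrable_right _).div_const d)
            (Filter.Eventually.of_forall fun y => div_nonneg (hW.nonneg _) hpos.le)).symm
      _ = 1 := by rw [integral_div, hy, div_self hpos.ne', ENNReal.ofReal_one]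

/-- Each vertex carries a pair of which only one coordinate is read; the projections that forget the
other one preserve the measure. -/
theorem lintegral_edgeWeight_productKernel (hW : IsBigraphon W) (G : Bigraph V₁ V₂) {c : ℝ}
    (hc : 0 < c) :
    ∫⁻ z, edgeWeight (productKernel W c) G.edges z ∂(Measure.pi fun _ => μ.prod ν) =
      ENNReal.ofReal (G.density μ ν W / c ^ G.e) := by
  have h1 := measurePreserving_sumPiEquivProdPi (fun _ : V₁ ⊕ V₂ => μ.prod ν)
  have h2 := (measurePreserving_pi (fun _ : V₁ => μ.prod ν) (fun _ => μ)
    fun _ => measurePreserving_fst).prod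
    (measurePreserving_pi (fun _ : V₂ => μ.prod ν) (fun _ => ν) fun _ => measurePreserving_snd)
  have h3 := h2.comp h1
  have hm : Measurable fun z : (V₁ → X) × (V₂ → Y) =>
      ENNReal.ofReal ((∏ p ∈ G.edges, W (z.1 p.1, z.2 p.2)) / c ^ G.e) :=
    ((hW.measurable_prod G.edges).div_const _).ennreal_ofReal
  have h4 := h3.lintegral_comp hm
  rw [Bigraph.density, ← integral_div, ofReal_integral_eq_lintegral_ofReal
    ((hW.integrable_prod G.edges _).div_const _) (Filter.Eventually.of_forall fun z =>
      div_nonneg (Finset.prod_nonneg fun p _ => hW.nonneg _) (by positivity)), ← h4]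
  refine lintegral_congr fun z => ?_
  rw [edgeWeight, Bigraph.e, ← Finset.prod_const, ← Finset.prod_div_distrib,
    ENNReal.ofReal_prod_of_nonneg fun p _ => div_nonneg (hW.nonneg _) hc.le]
  push_cast
  rfl

end Density

/-! ### Weak domination of the core. -/

section Domination

variable {V₁ : Type u₁} {V₂ : Type u₂} [Fintype V₁] [Fintype V₂] {G : Bigraph V₁ V₂}
  {H₁ : Type u₃} {H₂ : Type u₄} [Fintype H₁] [Fintype H₂] {H : Bigraph H₁ H₂}

theorem ReflectiveTreeDecomposition.weaklyDominates (T : ReflectiveTreeDecomposition G)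
    (hcore : T.IsCore H)
    (hdom : ∀ U₁ U₂ : T.bags, T.tree.Adj U₁ U₂ →
      Bigraph.WeaklyDominates.{w, u₃, u₄, u₁, u₂} H (G.induce (U₁.1 ∩ U₂.1))) :
    Bigraph.WeaklyDominates.{w, u₁, u₂, u₃, u₄} G H := by
  intro X Y _ _ μ ν _ _ W hW hb h0
  have hpos := hW.rho_density_pos h0
  set d := Bigraph.rho.density μ ν W with hd
  have hP := isDoublyStochastic_productKernel hW hb hpos
  rw [← hd] at hP
  have hK := measurable_productKernel hW d
  have hC := productKernel_bounded hW hpos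
  have hrefl : ∀ U₁ U₂ : T.bags, T.tree.Adj U₁ U₂ →
      ∀ g : (V₁ ⊕ V₂ → X × Y) → ℝ≥0∞, Measurable g → DependsOn g (U₁.1 ∩ U₂.1) →
        ∫⁻ z, edgeWeight (productKernel W d) (G.within U₁.1) z * g z
          ∂(Measure.pi fun _ => μ.prod ν) =
        ∫⁻ z, edgeWeight (productKernel W d) (G.within U₂.1) z * g z
          ∂(Measure.pi fun _ => μ.prod ν) :=
    fun U₁ U₂ h g hg hgS => lintegral_edgeWeight_of_isIsomorphic hK hP Set.inter_subset_left
      Set.inter_subset_right (T.reflective U₁ U₂ h) hg hgS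
  set t := (H.density μ ν W / d ^ H.e).toNNReal with ht
  have htH : ∫⁻ z, edgeWeight (productKernel W d) H.edges z ∂(Measure.pi fun _ => μ.prod ν) = t :=
    lintegral_edgeWeight_productKernel hW H hpos
  have hbag : ∀ U ∈ T.bags, ∫⁻ z, edgeWeight (productKernel W d) (G.within U) z
      ∂(Measure.pi fun _ => μ.prod ν) = t := by
    obtain ⟨U₀, hU₀, ⟨f⟩⟩ := hcore
    have hU₀t := (lintegral_edgeWeight_of_iso hK hP f).symm.trans htH
    intro U hU
    obtain ⟨p⟩ := T.isTree.connected.preconnected ⟨U₀, hU₀⟩ ⟨U, hU⟩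
    -- Equality of marginals, tested against 1, carries the total weight along every walk of the
    -- tree.
    suffices h : ∀ (U₁ U₂ : T.bags), T.tree.Walk U₁ U₂ →
        ∫⁻ z, edgeWeight (productKernel W d) (G.within U₁.1) z
          ∂(Measure.pi fun _ => μ.prod ν) =
        ∫⁻ z, edgeWeight (productKernel W d) (G.within U₂.1) z
          ∂(Measure.pi fun _ => μ.prod ν) from (h _ _ p).symm.trans hU₀t
    intro U₁ U₂ p
    induction p with
    | nil => rfl
    | cons h _ ih =>
      have := hrefl _ _ h (fun _ => 1) measurable_const fun _ _ _ => rfl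
      simp only [mul_one] at this
      exact this.trans ih
  have hnonneg : 0 ≤ G.density μ ν W / d ^ G.e := div_nonneg (hW.density_nonneg G) (by positivity)
  rw [← ENNReal.ofReal_le_ofReal_iff hnonneg,
    ← lintegral_edgeWeight_productKernel hW G hpos]
  change (t : ℝ≥0∞) ≤ _
  by_cases ht0 : t = 0
  · simp [ht0]
  refine T.le_lintegral_edgeWeight hK hC ht0 hbag hrefl fun U₁ U₂ h => ?_
  rw [lintegral_edgeWeight_within hK, lintegral_edgeWeight_productKernel hW _ hpos]
  exact ENNReal.ofReal_le_ofReal (hdom U₁ U₂ h X Y μ ν W hW hb h0)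

end Domination

/-! ### Restriction to a product set of large minimum degree. -/

section MinimumDegree

variable {X Y : Type w} [MeasurableSpace X] [MeasurableSpace Y] {μ : Measure X} {ν : Measure Y}
  [IsProbabilityMeasure μ] [IsProbabilityMeasure ν]

/-- The sets that remain when points of degree less than `ε` are removed `n` times. -/
noncomputable def pruneSeq (μ : Measure X) (ν : Measure Y) (w : X × Y → ℝ≥0∞) (ε : ℝ≥0∞) :
    ℕ → Set X × Set Y
  | 0 => (Set.univ, Set.univ)
  | n + 1 =>
    ({x | x ∈ (pruneSeq μ ν w ε n).1 ∧ ε ≤ ∫⁻ y in (pruneSeq μ ν w ε n).2, w (x, y) ∂ν},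
      {y | y ∈ (pruneSeq μ ν w ε n).2 ∧ ε ≤ ∫⁻ x in (pruneSeq μ ν w ε n).1, w (x, y) ∂μ})

theorem measurableSet_pruneSeq {w : X × Y → ℝ≥0∞} (hw : Measurable w) (ε : ℝ≥0∞) (n : ℕ) :
    MeasurableSet (pruneSeq μ ν w ε n).1 ∧ MeasurableSet (pruneSeq μ ν w ε n).2 := by
  induction n with
  | zero => exact ⟨.univ, .univ⟩
  | succ n ih =>
    exact ⟨ih.1.inter (measurableSet_le measurable_const hw.lintegral_prod_right'),
      ih.2.inter (measurableSet_le measurable_const hw.lintegral_prod_left')⟩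

omit [IsProbabilityMeasure μ] [IsProbabilityMeasure ν] in
theorem antitone_pruneSeq (w : X × Y → ℝ≥0∞) (ε : ℝ≥0∞) : Antitone (pruneSeq μ ν w ε) :=
  antitone_nat_of_succ_le fun _ => ⟨fun _ h => h.1, fun _ h => h.1⟩

omit [IsProbabilityMeasure μ] in
theorem measure_compl_add_sdiff {S S' : Set X} (hS : MeasurableSet S) (hS' : MeasurableSet S')
    (h : S' ⊆ S) : μ Sᶜ + μ (S \ S') = μ S'ᶜ := by
  rw [← measure_union (disjoint_compl_left.mono_right Set.sdiff_subset) (hS.diff hS')]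
  congr 1
  ext x
  by_cases hx : x ∈ S
  · simp [hx]
  · simpa [hx] using fun h' => hx (h h')

/-- A point is removed when its remaining degree is below `ε`, so the weight lost with it can be
charged to its own measure, and no point is charged twice. -/
theorem lintegral_le_pruneSeq {w : X × Y → ℝ≥0∞} (hw : Measurable w) (ε : ℝ≥0∞) (n : ℕ) :
    ∫⁻ z, w z ∂(μ.prod ν) ≤
      ∫⁻ z in (pruneSeq μ ν w ε n).1 ×ˢ (pruneSeq μ ν w ε n).2, w z ∂(μ.prod ν) +
        ε * μ (pruneSeq μ ν w ε n).1ᶜ + ε * ν (pruneSeq μ ν w ε n).2ᶜ := by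
  induction n with
  | zero => simp [pruneSeq]
  | succ n ih =>
    have hA := (measurableSet_pruneSeq (μ := μ) (ν := ν) hw ε n).1
    have hB := (measurableSet_pruneSeq (μ := μ) (ν := ν) hw ε n).2
    have hA' := (measurableSet_pruneSeq (μ := μ) (ν := ν) hw ε (n + 1)).1
    have hB' := (measurableSet_pruneSeq (μ := μ) (ν := ν) hw ε (n + 1)).2
    have hle := antitone_pruneSeq (μ := μ) (ν := ν) w ε n.le_succ
    have hdefA : ∀ x ∈ (pruneSeq μ ν w ε n).1, x ∉ (pruneSeq μ ν w ε (n + 1)).1 →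
        ∫⁻ y in (pruneSeq μ ν w ε n).2, w (x, y) ∂ν ≤ ε := fun x hx hx' =>
      le_of_not_ge fun h => hx' ⟨hx, h⟩
    have hdefB : ∀ y ∈ (pruneSeq μ ν w ε n).2, y ∉ (pruneSeq μ ν w ε (n + 1)).2 →
        ∫⁻ x in (pruneSeq μ ν w ε n).1, w (x, y) ∂μ ≤ ε := fun y hy hy' =>
      le_of_not_ge fun h => hy' ⟨hy, h⟩
    have hAA : (pruneSeq μ ν w ε (n + 1)).1 ⊆ (pruneSeq μ ν w ε n).1 := hle.1
    have hBB : (pruneSeq μ ν w ε (n + 1)).2 ⊆ (pruneSeq μ ν w ε n).2 := hle.2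
    generalize (pruneSeq μ ν w ε n).1 = A at *
    generalize (pruneSeq μ ν w ε n).2 = B at *
    generalize (pruneSeq μ ν w ε (n + 1)).1 = A' at *
    generalize (pruneSeq μ ν w ε (n + 1)).2 = B' at *
    have hcover : A ×ˢ B ⊆ A' ×ˢ B' ∪ ((A \ A') ×ˢ B ∪ A ×ˢ (B \ B')) := by
      rintro ⟨x, y⟩ ⟨hx, hy⟩
      simp only [Set.mem_union, Set.mem_prod, Set.mem_sdiff] at hx hy ⊢
      tauto
    have h1 : ∫⁻ z in (A \ A') ×ˢ B, w z ∂(μ.prod ν) ≤ ε * μ (A \ A') := by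
      rw [setLIntegral_prod _ hw.aemeasurable]
      calc _ ≤ ∫⁻ _ in A \ A', ε ∂μ :=
            setLIntegral_mono' (hA.diff hA') fun x hx => hdefA x hx.1 hx.2
        _ = _ := by simp
    have h2 : ∫⁻ z in A ×ˢ (B \ B'), w z ∂(μ.prod ν) ≤ ε * ν (B \ B') := by
      rw [setLIntegral_prod_symm _ hw.aemeasurable]
      calc _ ≤ ∫⁻ _ in B \ B', ε ∂ν :=
            setLIntegral_mono' (hB.diff hB') fun y hy => hdefB y hy.1 hy.2
        _ = _ := by simp
    calc ∫⁻ z, w z ∂(μ.prod ν) ≤ _ := ih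
      _ ≤ (∫⁻ z in A' ×ˢ B', w z ∂(μ.prod ν) + (ε * μ (A \ A') + ε * ν (B \ B'))) +
          ε * μ Aᶜ + ε * ν Bᶜ := by
          gcongr
          refine (lintegral_mono_set hcover).trans ((lintegral_union_le _ _ _).trans ?_)
          gcongr
          exact (lintegral_union_le _ _ _).trans (add_le_add h1 h2)
      _ = _ := by
          rw [← measure_compl_add_sdiff hA hA' hAA, ← measure_compl_add_sdiff hB hB' hBB]
          ring

omit [IsProbabilityMeasure ν] in
-- Continuity from above of the finite measure with density `w`.
theorem le_setLIntegral_iInter {w : Y → ℝ≥0∞} (hfin : ∫⁻ y, w y ∂ν ≠ ∞)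
    {B : ℕ → Set Y} (hB : ∀ n, MeasurableSet (B n)) (hanti : Antitone B) {c : ℝ≥0∞}
    (hc : ∀ n, c ≤ ∫⁻ y in B n, w y ∂ν) : c ≤ ∫⁻ y in ⋂ n, B n, w y ∂ν := by
  have h := tendsto_measure_iInter_atTop (μ := ν.withDensity w)
    (fun n => (hB n).nullMeasurableSet) hanti ⟨0, ne_top_of_le_ne_top hfin (by
      rw [withDensity_apply _ (hB 0)]; exact setLIntegral_le_lintegral _ _)⟩
  rw [withDensity_apply _ (MeasurableSet.iInter hB)] at h
  refine ge_of_tendsto' h fun n => ?_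
  rw [Function.comp, withDensity_apply _ (hB n)]
  exact hc n

/-- Every bigraphon has a restriction to a product set in which all degrees are at least `ε`, and
which loses at most `2 * ε` of its weight. -/
theorem exists_minDegree {w : X × Y → ℝ≥0∞} (hw : Measurable w)
    (hfin : ∫⁻ z, w z ∂(μ.prod ν) ≠ ∞) (hx : ∀ x, ∫⁻ y, w (x, y) ∂ν ≠ ∞)
    (hy : ∀ y, ∫⁻ x, w (x, y) ∂μ ≠ ∞) (ε : ℝ≥0∞) :
    ∃ A B, MeasurableSet A ∧ MeasurableSet B ∧ (∀ x ∈ A, ε ≤ ∫⁻ y in B, w (x, y) ∂ν) ∧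
      (∀ y ∈ B, ε ≤ ∫⁻ x in A, w (x, y) ∂μ) ∧
      ∫⁻ z, w z ∂(μ.prod ν) ≤ ∫⁻ z in A ×ˢ B, w z ∂(μ.prod ν) + 2 * ε := by
  have hm := measurableSet_pruneSeq (μ := μ) (ν := ν) hw ε
  have hanti := antitone_pruneSeq (μ := μ) (ν := ν) w ε
  have hA : Antitone fun n => (pruneSeq μ ν w ε n).1 := fun _ _ h => (hanti h).1
  have hB : Antitone fun n => (pruneSeq μ ν w ε n).2 := fun _ _ h => (hanti h).2
  refine ⟨⋂ n, (pruneSeq μ ν w ε n).1, ⋂ n, (pruneSeq μ ν w ε n).2,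
    .iInter fun n => (hm n).1, .iInter fun n => (hm n).2, fun x h => ?_, fun y h => ?_, ?_⟩
  -- Survival to stage n + 1 bounds the degree into the n-th set.
  · exact le_setLIntegral_iInter (hx x) (fun n => (hm n).2) hB fun n =>
      (Set.mem_iInter.1 h (n + 1)).2
  · exact le_setLIntegral_iInter (hy y) (fun n => (hm n).1) hA fun n =>
      (Set.mem_iInter.1 h (n + 1)).2
  · have hprod : (⋂ n, (pruneSeq μ ν w ε n).1) ×ˢ (⋂ n, (pruneSeq μ ν w ε n).2) =
        ⋂ n, (pruneSeq μ ν w ε n).1 ×ˢ (pruneSeq μ ν w ε n).2 := by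
      ext z
      simp [forall_and]
    rw [hprod, ← tsub_le_iff_right]
    refine le_setLIntegral_iInter hfin (fun n => (hm n).1.prod (hm n).2)
      (fun _ _ h => Set.prod_mono (hA h) (hB h)) fun n => ?_
    rw [tsub_le_iff_right]
    refine (lintegral_le_pruneSeq hw ε n).trans ?_
    rw [add_assoc, two_mul]
    gcongr <;> exact mul_le_of_le_one_right' prob_le_one

/-- The restriction of a bigraphon to a product set in which all degrees are at least a quarter of
the edge density. -/
theorem IsBigraphon.exists_minDegree {W : X × Y → ℝ} (hW : IsBigraphon W) :
    ∃ W' : X × Y → ℝ, IsBigraphon W' ∧ (∀ z, W' z ≤ W z) ∧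
      (∀ x y, W' (x, y) ≠ 0 → (∫ z, W z ∂(μ.prod ν)) / 4 ≤ ∫ y, W' (x, y) ∂ν ∧
        (∫ z, W z ∂(μ.prod ν)) / 4 ≤ ∫ x, W' (x, y) ∂μ) ∧
      (∫ z, W z ∂(μ.prod ν)) / 2 ≤ ∫ z, W' z ∂(μ.prod ν) := by
  set d := ∫ z, W z ∂(μ.prod ν) with hd
  have hd0 : 0 ≤ d := integral_nonneg hW.nonneg
  have hfin := (hW.integrable (μ.prod ν)).lintegral_lt_top
  -- With the threshold d / 4 the loss is at most 2 (d / 4) = d / 2.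
  obtain ⟨A, B, hA, hB, hxA, hyB, hAB⟩ := _root_.exists_minDegree (μ := μ) (ν := ν)
    hW.measurable.ennreal_ofReal hfin.ne (fun x => (hW.integrable_left x).lintegral_lt_top.ne)
    (fun y => (hW.integrable_right y).lintegral_lt_top.ne) (ENNReal.ofReal (d / 4))
  have hle : ∀ z, (A ×ˢ B).indicator W z ≤ W z := fun z =>
    Set.indicator_le_self' (fun z _ => hW.nonneg z) z
  refine ⟨(A ×ˢ B).indicator W, ⟨hW.measurable.indicator (hA.prod hB),
    Set.indicator_nonneg fun z _ => hW.nonneg z,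
    hW.bounded.imp fun C hC z => (hle z).trans (hC z)⟩, hle, fun x y h => ?_, ?_⟩
  · obtain ⟨hx, hy⟩ : x ∈ A ∧ y ∈ B := Set.mem_prod.1 (Set.mem_of_indicator_ne_zero h)
    have h1 : ∀ y', (A ×ˢ B).indicator W (x, y') = B.indicator (fun y' => W (x, y')) y' :=
      fun y' => by
      by_cases h' : y' ∈ B
      · rw [Set.indicator_of_mem (Set.mk_mem_prod hx h'), Set.indicator_of_mem h']
      · rw [Set.indicator_of_notMem (fun h'' => h' (Set.mem_prod.1 h'').2),
          Set.indicator_of_notMem h']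
    have h2 : ∀ x', (A ×ˢ B).indicator W (x', y) = A.indicator (fun x' => W (x', y)) x' :=
      fun x' => by
      by_cases h' : x' ∈ A
      · rw [Set.indicator_of_mem (Set.mk_mem_prod h' hy), Set.indicator_of_mem h']
      · rw [Set.indicator_of_notMem (fun h'' => h' (Set.mem_prod.1 h'').1),
          Set.indicator_of_notMem h']
    simp only [h1, h2, integral_indicator hA, integral_indicator hB]
    constructor
    · have := hxA x hx
      rwa [← ofReal_integral_eq_lintegral_ofReal (hW.integrable_left x).integrableOn
        (Filter.Eventually.of_forall fun y => hW.nonneg _),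
        ENNReal.ofReal_le_ofReal_iff (integral_nonneg fun _ => hW.nonneg _)] at this
    · have := hyB y hy
      rwa [← ofReal_integral_eq_lintegral_ofReal (hW.integrable_right y).integrableOn
        (Filter.Eventually.of_forall fun y => hW.nonneg _),
        ENNReal.ofReal_le_ofReal_iff (integral_nonneg fun _ => hW.nonneg _)] at this
  · rw [integral_indicator (hA.prod hB)]
    rw [← ofReal_integral_eq_lintegral_ofReal (hW.integrable _)
        (Filter.Eventually.of_forall hW.nonneg), ← ofReal_integral_eq_lintegral_ofReal
        (hW.integrable _).integrableOn (Filter.Eventually.of_forall hW.nonneg),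
        show (2 : ℝ≥0∞) = ENNReal.ofReal 2 by simp, ← ENNReal.ofReal_mul (by norm_num),
        ← ENNReal.ofReal_add (integral_nonneg hW.nonneg) (by positivity),
        ENNReal.ofReal_le_ofReal_iff
          (add_nonneg (integral_nonneg hW.nonneg) (by positivity)), ← hd] at hAB
    linarith

end MinimumDegree

/-! ### Measures reweighted by degrees. -/

section DegreeMeasure

/-- On a box the integrand is a product of functions of single coordinates, which are independent.
-/
theorem pi_withDensity {V : Type*} [Fintype V] {X : Type*} [MeasurableSpace X] (μ : Measure X)
    [IsProbabilityMeasure μ] {f : X → ℝ≥0∞} (hf : Measurable f)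
    [IsProbabilityMeasure (μ.withDensity f)] :
    (Measure.pi fun _ : V => μ.withDensity f) =
      (Measure.pi fun _ : V => μ).withDensity fun x => ∏ v, f (x v) := by
  refine Measure.pi_eq fun s hs => ?_
  rw [withDensity_apply _ (MeasurableSet.univ_pi hs),
    ← lintegral_indicator (MeasurableSet.univ_pi hs)]
  have hm : ∀ v, Measurable ((s v).indicator f) := fun v => hf.indicator (hs v)
  have h1 : ∀ x : V → X, (Set.univ.pi s).indicator (fun x => ∏ v, f (x v)) x =
      ∏ v, (s v).indicator f (x v) := by
    intro x
    by_cases hx : x ∈ Set.univ.pi s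
    · rw [Set.indicator_of_mem hx]
      exact Finset.prod_congr rfl fun v _ =>
        (Set.indicator_of_mem (Set.mem_univ_pi.1 hx v) _).symm
    · rw [Set.indicator_of_notMem hx]
      obtain ⟨v, hv⟩ : ∃ v, x v ∉ s v := by simpa [Set.mem_univ_pi] using hx
      exact (Finset.prod_eq_zero (Finset.mem_univ v) (Set.indicator_of_notMem hv _)).symm
  simp only [h1]
  have hind := ProbabilityTheory.iIndepFun_pi (μ := fun _ : V => μ)
    (X := fun v => (s v).indicator f) fun v => (hm v).aemeasurable
  have h2 := ProbabilityTheory.lintegral_prod_eq_prod_lintegral_of_indepFun Finset.univ _ hind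
    fun v => (hm v).comp (measurable_pi_apply v)
  rw [h2]
  refine Finset.prod_congr rfl fun v _ => ?_
  rw [withDensity_apply _ (hs v), ← lintegral_indicator (hs v)]
  exact (measurePreserving_eval (fun _ : V => μ) v).lintegral_comp (hm v)

variable {X : Type w} [MeasurableSpace X]

/-- The measure `μ` reweighted by the degrees `a`, normalised by the density `d`. -/
noncomputable def degreeMeasure (μ : Measure X) (a : X → ℝ) (d : ℝ) : Measure X :=
  μ.withDensity fun x => ENNReal.ofReal (a x / d)

variable {μ : Measure X} [IsProbabilityMeasure μ] {a : X → ℝ} {d : ℝ}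

omit [IsProbabilityMeasure μ] in
theorem isProbabilityMeasure_degreeMeasure (ha : Integrable a μ) (ha0 : ∀ x, 0 ≤ a x)
    (hd : 0 < d) (had : ∫ x, a x ∂μ = d) : IsProbabilityMeasure (degreeMeasure μ a d) := by
  constructor
  rw [degreeMeasure, withDensity_apply _ .univ, Measure.restrict_univ,
    ← ofReal_integral_eq_lintegral_ofReal (ha.div_const d)
      (Filter.Eventually.of_forall fun x => div_nonneg (ha0 x) hd.le),
    integral_div, had, div_self hd.ne', ENNReal.ofReal_one]

omit [IsProbabilityMeasure μ] in
-- Rows of degree 0 cannot be normalised; this makes them negligible for biregularity.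
theorem ae_degreeMeasure_ne_zero (ha : Measurable a) : ∀ᵐ x ∂(degreeMeasure μ a d), a x ≠ 0 := by
  rw [degreeMeasure, ae_withDensity_iff (ha.div_const d).ennreal_ofReal]
  refine Filter.Eventually.of_forall fun x hx h => hx ?_
  simp [h]

omit [IsProbabilityMeasure μ] in
theorem integral_degreeMeasure (ha : Measurable a) (ha0 : ∀ x, 0 ≤ a x) (hd : 0 < d) (g : X → ℝ) :
    ∫ x, g x ∂(degreeMeasure μ a d) = ∫ x, a x / d * g x ∂μ := by
  rw [degreeMeasure, integral_withDensity_eq_integral_toReal_smul (ha.div_const d).ennreal_ofReal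
    (Filter.Eventually.of_forall fun _ => ENNReal.ofReal_lt_top)]
  refine integral_congr_ae (Filter.Eventually.of_forall fun x => ?_)
  simp only [smul_eq_mul]
  rw [ENNReal.toReal_ofReal (div_nonneg (ha0 x) hd.le)]

omit [IsProbabilityMeasure μ] in
theorem integral_row_degreeMeasure (ha : Measurable a) (ha0 : ∀ x, 0 ≤ a x) (hd : 0 < d)
    {f : X → ℝ} (hf : ∀ x, a x = 0 → f x = 0) {b : ℝ} (hb : b ≠ 0) (hfb : ∫ x, f x ∂μ = b) :
    ∫ x, d * f x / (a x * b) ∂(degreeMeasure μ a d) = 1 := by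
  rw [integral_degreeMeasure ha ha0 hd]
  calc _ = ∫ x, f x / b ∂μ := integral_congr_ae (Filter.Eventually.of_forall fun x => by
        by_cases h : a x = 0
        · simp [h, hf x h]
        · have := hd.ne'
          simp only
          field_simp)
    _ = 1 := by rw [integral_div, hfb, div_self hb]

end DegreeMeasure

/-! ### Making a bigraphon biregular at the cost of a constant factor. -/

section Regularization

/-- If every value of `a` occurs in a product, then the product is at least that of the values and of
lower bounds for the remaining factors. -/
theorem prod_mul_pow_le_prod {V E : Type*} [Fintype V] [DecidableEq E] (F : Finset E) (π : E → V)
    (σ : V → E) (hσ : ∀ v, σ v ∈ F) (hπσ : ∀ v, π (σ v) = v) {a : V → ℝ} {δ : ℝ} (hδ : 0 ≤ δ)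
    (ha : ∀ v, δ ≤ a v) :
    (∏ v, a v) * δ ^ (F.card - Fintype.card V) ≤ ∏ p ∈ F, a (π p) := by
  have hinj : Function.Injective σ := Function.LeftInverse.injective hπσ
  have hsub : Finset.univ.image σ ⊆ F := by
    intro p hp
    obtain ⟨v, -, rfl⟩ := Finset.mem_image.1 hp
    exact hσ v
  have h1 : ∏ p ∈ Finset.univ.image σ, a (π p) = ∏ v, a v := by
    rw [Finset.prod_image fun _ _ _ _ h => hinj h]
    exact Finset.prod_congr rfl fun v _ => by rw [hπσ]
  have h2 : (F \ Finset.univ.image σ).card = F.card - Fintype.card V := by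
    rw [Finset.card_sdiff_of_subset hsub, Finset.card_image_of_injective _ hinj, Finset.card_univ]
  rw [← Finset.prod_sdiff hsub, h1, ← h2, mul_comm]
  refine mul_le_mul_of_nonneg_right ?_ (Finset.prod_nonneg fun v _ => hδ.trans (ha v))
  rw [← Finset.prod_const]
  exact Finset.prod_le_prod (fun _ _ => hδ) fun p _ => ha _

variable {V₁ : Type u₁} {V₂ : Type u₂} [Fintype V₁] [Fintype V₂] {X Y : Type w}
  [MeasurableSpace X] [MeasurableSpace Y]

/-- The biregular function that is obtained from `W` by normalising with its marginals. -/
noncomputable def regularize (μ : Measure X) (ν : Measure Y) (W : X × Y → ℝ) (z : X × Y) : ℝ :=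
  (∫ z, W z ∂(μ.prod ν)) * W z / ((∫ y, W (z.1, y) ∂ν) * ∫ x, W (x, z.2) ∂μ)

variable {μ : Measure X} {ν : Measure Y} [IsProbabilityMeasure μ] [IsProbabilityMeasure ν]
  {W : X × Y → ℝ}

theorem IsBigraphon.measurable_left (hW : IsBigraphon W) : Measurable fun x => ∫ y, W (x, y) ∂ν :=
  hW.measurable.stronglyMeasurable.integral_prod_right'.measurable

theorem IsBigraphon.measurable_right (hW : IsBigraphon W) : Measurable fun y => ∫ x, W (x, y) ∂μ :=
  hW.measurable.stronglyMeasurable.integral_prod_left'.measurable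

variable {δ : ℝ}

/-- The degree bound on the support keeps the denominator at least δ² there; without it the quotient
could be unbounded. -/
theorem isBigraphon_regularize (hW : IsBigraphon W) (hδ : 0 < δ)
    (hdeg : ∀ x y, W (x, y) ≠ 0 → δ ≤ ∫ y, W (x, y) ∂ν ∧ δ ≤ ∫ x, W (x, y) ∂μ) :
    IsBigraphon (regularize μ ν W) := by
  have hd : 0 ≤ ∫ z, W z ∂(μ.prod ν) := integral_nonneg hW.nonneg
  refine ⟨?_, fun z => ?_, ?_⟩
  · exact (hW.measurable.const_mul _).div ((hW.measurable_left.comp measurable_fst).mul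
      (hW.measurable_right.comp measurable_snd))
  · exact div_nonneg (mul_nonneg hd (hW.nonneg z))
      (mul_nonneg (integral_nonneg fun _ => hW.nonneg _) (integral_nonneg fun _ => hW.nonneg _))
  · obtain ⟨C, hC⟩ := hW.bounded
    refine ⟨(∫ z, W z ∂(μ.prod ν)) * C / (δ * δ), fun z => ?_⟩
    have hC0 : 0 ≤ C := (hW.nonneg z).trans (hC z)
    by_cases hz : W z = 0
    · rw [regularize, hz]
      simp only [mul_zero, zero_div]
      positivity
    · obtain ⟨h1, h2⟩ := hdeg z.1 z.2 hz
      unfold regularize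
      have h3 := hδ.le.trans h1
      gcongr
      exact hC z

omit [IsProbabilityMeasure ν] in
theorem integral_regularize_left (hW : IsBigraphon W) (hδ : 0 < δ)
    (hdeg : ∀ x y, W (x, y) ≠ 0 → δ ≤ ∫ y, W (x, y) ∂ν ∧ δ ≤ ∫ x, W (x, y) ∂μ)
    (hd : 0 < ∫ z, W z ∂(μ.prod ν)) {x : X} (hx : ∫ y, W (x, y) ∂ν ≠ 0) :
    ∫ y, regularize μ ν W (x, y)
      ∂(degreeMeasure ν (fun y => ∫ x, W (x, y) ∂μ) (∫ z, W z ∂(μ.prod ν))) = 1 := by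
  rw [← integral_row_degreeMeasure (μ := ν) (a := fun y => ∫ x, W (x, y) ∂μ)
    (f := fun y => W (x, y)) hW.measurable_right
    (fun y => integral_nonneg fun _ => hW.nonneg _) hd (fun y hy => ?_) hx rfl]
  · refine integral_congr_ae (Filter.Eventually.of_forall fun y => ?_)
    simp only [regularize]
    rw [mul_comm (∫ y, W (x, y) ∂ν)]
  · by_contra h
    have := (hdeg x y h).2
    linarith

omit [IsProbabilityMeasure μ] in
theorem integral_regularize_right (hW : IsBigraphon W) (hδ : 0 < δ)
    (hdeg : ∀ x y, W (x, y) ≠ 0 → δ ≤ ∫ y, W (x, y) ∂ν ∧ δ ≤ ∫ x, W (x, y) ∂μ)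
    (hd : 0 < ∫ z, W z ∂(μ.prod ν)) {y : Y} (hy : ∫ x, W (x, y) ∂μ ≠ 0) :
    ∫ x, regularize μ ν W (x, y)
      ∂(degreeMeasure μ (fun x => ∫ y, W (x, y) ∂ν) (∫ z, W z ∂(μ.prod ν))) = 1 := by
  rw [← integral_row_degreeMeasure (μ := μ) (a := fun x => ∫ y, W (x, y) ∂ν)
    (f := fun x => W (x, y)) hW.measurable_left
    (fun x => integral_nonneg fun _ => hW.nonneg _) hd (fun x hx => ?_) hy rfl]
  · rfl
  · by_contra h
    have := (hdeg x y h).1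
    linarith

theorem IsBigraphon.integrable_leftDegree (hW : IsBigraphon W) :
    Integrable (fun x => ∫ y, W (x, y) ∂ν) μ :=
  (hW.integrable (μ.prod ν)).integral_prod_left

theorem IsBigraphon.integrable_rightDegree (hW : IsBigraphon W) :
    Integrable (fun y => ∫ x, W (x, y) ∂μ) ν :=
  (hW.integrable (μ.prod ν)).integral_prod_right

theorem isProbabilityMeasure_leftDegree (hW : IsBigraphon W) (hd : 0 < ∫ z, W z ∂(μ.prod ν)) :
    IsProbabilityMeasure
      (degreeMeasure μ (fun x => ∫ y, W (x, y) ∂ν) (∫ z, W z ∂(μ.prod ν))) :=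
  isProbabilityMeasure_degreeMeasure hW.integrable_leftDegree
    (fun _ => integral_nonneg fun _ => hW.nonneg _) hd (integral_prod W (hW.integrable _)).symm

theorem isProbabilityMeasure_rightDegree (hW : IsBigraphon W) (hd : 0 < ∫ z, W z ∂(μ.prod ν)) :
    IsProbabilityMeasure
      (degreeMeasure ν (fun y => ∫ x, W (x, y) ∂μ) (∫ z, W z ∂(μ.prod ν))) :=
  isProbabilityMeasure_degreeMeasure hW.integrable_rightDegree
    (fun _ => integral_nonneg fun _ => hW.nonneg _) hd
    (integral_prod_symm W (hW.integrable _)).symm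

theorem rho_density_regularize (hW : IsBigraphon W) (hδ : 0 < δ)
    (hdeg : ∀ x y, W (x, y) ≠ 0 → δ ≤ ∫ y, W (x, y) ∂ν ∧ δ ≤ ∫ x, W (x, y) ∂μ)
    (hd : 0 < ∫ z, W z ∂(μ.prod ν)) :
    Bigraph.rho.density (degreeMeasure μ (fun x => ∫ y, W (x, y) ∂ν) (∫ z, W z ∂(μ.prod ν)))
      (degreeMeasure ν (fun y => ∫ x, W (x, y) ∂μ) (∫ z, W z ∂(μ.prod ν)))
      (regularize μ ν W) = 1 := by
  have h1 := isProbabilityMeasure_leftDegree hW hd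
  have h2 := isProbabilityMeasure_rightDegree hW hd
  have hR := isBigraphon_regularize hW hδ hdeg
  rw [rho_density _ hR.measurable, integral_prod _ (hR.integrable _)]
  rw [integral_congr_ae (g := fun _ => (1 : ℝ))]
  · simp
  · filter_upwards [ae_degreeMeasure_ne_zero hW.measurable_left] with x hx
    exact integral_regularize_left hW hδ hdeg hd hx

theorem isBiregular_regularize (hW : IsBigraphon W) (hδ : 0 < δ)
    (hdeg : ∀ x y, W (x, y) ≠ 0 → δ ≤ ∫ y, W (x, y) ∂ν ∧ δ ≤ ∫ x, W (x, y) ∂μ)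
    (hd : 0 < ∫ z, W z ∂(μ.prod ν)) :
    IsBiregular (degreeMeasure μ (fun x => ∫ y, W (x, y) ∂ν) (∫ z, W z ∂(μ.prod ν)))
      (degreeMeasure ν (fun y => ∫ x, W (x, y) ∂μ) (∫ z, W z ∂(μ.prod ν)))
      (regularize μ ν W) := by
  rw [IsBiregular, rho_density_regularize hW hδ hdeg hd]
  constructor
  · filter_upwards [ae_degreeMeasure_ne_zero hW.measurable_left] with x hx
    exact integral_regularize_left hW hδ hdeg hd hx
  · filter_upwards [ae_degreeMeasure_ne_zero hW.measurable_right] with y hy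
    exact integral_regularize_right hW hδ hdeg hd hy

/-- `G` has no isolated vertices. -/
def Bigraph.NoIsolated (G : Bigraph V₁ V₂) : Prop :=
  (∀ v, ∃ p ∈ G.edges, p.1 = v) ∧ ∀ w, ∃ p ∈ G.edges, p.2 = w

/-- The change of weights and measures from `W` to its regularization, at one point. -/
theorem Bigraph.NoIsolated.weight_le {G : Bigraph V₁ V₂} (hG : G.NoIsolated) {a : V₁ → ℝ}
    {b : V₂ → ℝ} {ω : V₁ × V₂ → ℝ} {d : ℝ} (hδ : 0 < δ) (hd : 0 < d) (hω : ∀ p, 0 ≤ ω p)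
    (hab : ∀ p, ω p ≠ 0 → δ ≤ a p.1 ∧ δ ≤ b p.2) :
    ((∏ v, a v / d) * ∏ w, b w / d) * ∏ p ∈ G.edges, d * ω p / (a p.1 * b p.2) ≤
      d ^ G.e / (d ^ Fintype.card V₁ * d ^ Fintype.card V₂ *
        (δ ^ (G.e - Fintype.card V₁) * δ ^ (G.e - Fintype.card V₂))) * ∏ p ∈ G.edges, ω p := by
  classical
  -- If an edge has weight 0, both sides vanish. Otherwise every vertex lies on an edge of non-zero
  -- weight, so all degrees are at least δ.
  by_cases h0 : ∃ p ∈ G.edges, ω p = 0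
  · obtain ⟨p, hp, h0⟩ := h0
    rw [Finset.prod_eq_zero hp h0, Finset.prod_eq_zero hp (by simp [h0])]
    simp
  push Not at h0
  choose σ hσ hσ' using hG.1
  choose τ hτ hτ' using hG.2
  have ha : ∀ v, δ ≤ a v := fun v => hσ' v ▸ (hab _ (h0 _ (hσ v))).1
  have hb : ∀ w, δ ≤ b w := fun w => hτ' w ▸ (hab _ (h0 _ (hτ w))).2
  have h1 := prod_mul_pow_le_prod G.edges Prod.fst σ hσ hσ' hδ.le ha
  have h2 := prod_mul_pow_le_prod G.edges Prod.snd τ hτ hτ' hδ.le hb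
  change _ * δ ^ (G.e - _) ≤ _ at h1
  change _ * δ ^ (G.e - _) ≤ _ at h2
  have hA : 0 < ∏ v, a v := Finset.prod_pos fun v _ => hδ.trans_le (ha v)
  have hB : 0 < ∏ w, b w := Finset.prod_pos fun w _ => hδ.trans_le (hb w)
  have hAE : 0 < ∏ p ∈ G.edges, a p.1 := Finset.prod_pos fun p _ => hδ.trans_le (ha _)
  have hBE : 0 < ∏ p ∈ G.edges, b p.2 := Finset.prod_pos fun p _ => hδ.trans_le (hb _)
  have hΩ : 0 ≤ ∏ p ∈ G.edges, ω p := Finset.prod_nonneg fun p _ => hω p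
  simp only [Finset.prod_div_distrib, Finset.prod_mul_distrib, Finset.prod_const, Finset.card_univ]
  change _ * (d ^ G.e * _ / _) ≤ _
  generalize ∏ v, a v = A at *
  generalize ∏ w, b w = B at *
  generalize ∏ p ∈ G.edges, a p.1 = AE at *
  generalize ∏ p ∈ G.edges, b p.2 = BE at *
  generalize ∏ p ∈ G.edges, ω p = Ω at *
  have hk1 : 0 < δ ^ (G.e - Fintype.card V₁) := by positivity
  have hk2 : 0 < δ ^ (G.e - Fintype.card V₂) := by positivity
  generalize δ ^ (G.e - Fintype.card V₁) = k1 at *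
  generalize δ ^ (G.e - Fintype.card V₂) = k2 at *
  have h3 : A / AE ≤ 1 / k1 := by rw [div_le_div_iff₀ hAE hk1]; linarith
  have h4 : B / BE ≤ 1 / k2 := by rw [div_le_div_iff₀ hBE hk2]; linarith
  calc _ = (d ^ G.e / (d ^ Fintype.card V₁ * d ^ Fintype.card V₂)) * Ω * ((A / AE) * (B / BE)) := by
        field_simp
    _ ≤ (d ^ G.e / (d ^ Fintype.card V₁ * d ^ Fintype.card V₂)) * Ω * ((1 / k1) * (1 / k2)) := by
        gcongr
    _ = _ := by field_simp

/-- The density of the reweighted product measure is a product over the vertices; moved into the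
integrand, it leaves the pointwise bound `weight_le`. -/
theorem density_regularize_le {G : Bigraph V₁ V₂} (hG : G.NoIsolated) (hW : IsBigraphon W)
    (hδ : 0 < δ)
    (hdeg : ∀ x y, W (x, y) ≠ 0 → δ ≤ ∫ y, W (x, y) ∂ν ∧ δ ≤ ∫ x, W (x, y) ∂μ)
    (hd : 0 < ∫ z, W z ∂(μ.prod ν)) :
    G.density (degreeMeasure μ (fun x => ∫ y, W (x, y) ∂ν) (∫ z, W z ∂(μ.prod ν)))
      (degreeMeasure ν (fun y => ∫ x, W (x, y) ∂μ) (∫ z, W z ∂(μ.prod ν)))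
      (regularize μ ν W) ≤
    (∫ z, W z ∂(μ.prod ν)) ^ G.e / ((∫ z, W z ∂(μ.prod ν)) ^ Fintype.card V₁ *
      (∫ z, W z ∂(μ.prod ν)) ^ Fintype.card V₂ *
        (δ ^ (G.e - Fintype.card V₁) * δ ^ (G.e - Fintype.card V₂))) * G.density μ ν W := by
  set d := ∫ z, W z ∂(μ.prod ν) with hd_def
  set a := fun x => ∫ y, W (x, y) ∂ν with ha_def
  set b := fun y => ∫ x, W (x, y) ∂μ with hb_def
  have h1 : IsProbabilityMeasure (degreeMeasure μ a d) := isProbabilityMeasure_leftDegree hW hd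
  have h2 : IsProbabilityMeasure (degreeMeasure ν b d) := isProbabilityMeasure_rightDegree hW hd
  have ha : Measurable a := hW.measurable_left
  have hb : Measurable b := hW.measurable_right
  have ha0 : ∀ x, 0 ≤ a x := fun _ => integral_nonneg fun _ => hW.nonneg _
  have hb0 : ∀ y, 0 ≤ b y := fun _ => integral_nonneg fun _ => hW.nonneg _
  have haE : Measurable fun x => ENNReal.ofReal (a x / d) := (ha.div_const d).ennreal_ofReal
  have hbE : Measurable fun y => ENNReal.ofReal (b y / d) := (hb.div_const d).ennreal_ofReal
  have hpa : Measurable fun x : V₁ → X => ∏ v, ENNReal.ofReal (a (x v) / d) :=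
    Finset.measurable_fun_prod _ fun v _ => haE.comp (measurable_pi_apply v)
  have hpb : Measurable fun y : V₂ → Y => ∏ w, ENNReal.ofReal (b (y w) / d) :=
    Finset.measurable_fun_prod _ fun w _ => hbE.comp (measurable_pi_apply w)
  have hlt : ∀ z : (V₁ → X) × (V₂ → Y), (∏ v, ENNReal.ofReal (a (z.1 v) / d)) *
      ∏ w, ENNReal.ofReal (b (z.2 w) / d) < ∞ := fun z =>
    ENNReal.mul_lt_top (ENNReal.prod_lt_top fun _ _ => ENNReal.ofReal_lt_top)
      (ENNReal.prod_lt_top fun _ _ => ENNReal.ofReal_lt_top)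
  have hmeas : (Measure.pi fun _ : V₁ => degreeMeasure μ a d).prod
      (Measure.pi fun _ : V₂ => degreeMeasure ν b d) =
      ((Measure.pi fun _ : V₁ => μ).prod (Measure.pi fun _ : V₂ => ν)).withDensity
        fun z => (∏ v, ENNReal.ofReal (a (z.1 v) / d)) * ∏ w, ENNReal.ofReal (b (z.2 w) / d) := by
    unfold degreeMeasure at h1 h2 ⊢
    rw [pi_withDensity μ haE, pi_withDensity ν hbE, prod_withDensity hpa hpb]
  have hR := isBigraphon_regularize hW hδ hdeg
  have hint := hR.integrable_prod G.edges
    ((Measure.pi fun _ : V₁ => degreeMeasure μ a d).prod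
      (Measure.pi fun _ : V₂ => degreeMeasure ν b d))
  have hm : Measurable fun z : (V₁ → X) × (V₂ → Y) =>
      (∏ v, ENNReal.ofReal (a (z.1 v) / d)) * ∏ w, ENNReal.ofReal (b (z.2 w) / d) :=
    (hpa.comp measurable_fst).mul (hpb.comp measurable_snd)
  rw [Bigraph.density, Bigraph.density, ← integral_const_mul]
  rw [hmeas] at hint ⊢
  rw [integral_withDensity_eq_integral_toReal_smul hm (Filter.Eventually.of_forall hlt)]
  refine integral_mono ((integrable_withDensity_iff_integrable_smul' hm
    (Filter.Eventually.of_forall hlt)).1 hint) ((hW.integrable_prod _ _).const_mul _) fun z => ?_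
  have h3 := hG.weight_le (a := fun v => a (z.1 v)) (b := fun w => b (z.2 w))
    (ω := fun p => W (z.1 p.1, z.2 p.2)) hδ hd (fun _ => hW.nonneg _) (fun p hp => hdeg _ _ hp)
  refine le_of_eq_of_le ?_ h3
  simp only [smul_eq_mul, ENNReal.toReal_mul, ENNReal.toReal_prod]
  simp only [ENNReal.toReal_ofReal (div_nonneg (ha0 _) hd.le),
    ENNReal.toReal_ofReal (div_nonneg (hb0 _) hd.le)]
  rfl

/-- If `G` satisfies Sidorenko's inequality for biregular bigraphons, then it satisfies it for all
bigraphons up to a constant factor. -/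
theorem Bigraph.NoIsolated.exists_const {G : Bigraph V₁ V₂} (hG : G.NoIsolated)
    (hreg : ∀ (X Y : Type w) [MeasurableSpace X] [MeasurableSpace Y] (μ : Measure X)
      (ν : Measure Y) [IsProbabilityMeasure μ] [IsProbabilityMeasure ν] (W : X × Y → ℝ),
      IsBigraphon W → IsBiregular μ ν W → ¬ W =ᵐ[μ.prod ν] 0 →
        rho.density μ ν W ^ G.e ≤ G.density μ ν W) :
    ∃ c : ℝ, 0 < c ∧ ∀ (X Y : Type w) [MeasurableSpace X] [MeasurableSpace Y] (μ : Measure X)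
      (ν : Measure Y) [IsProbabilityMeasure μ] [IsProbabilityMeasure ν] (W : X × Y → ℝ),
      IsBigraphon W → 0 < rho.density μ ν W →
        c * rho.density μ ν W ^ G.e ≤ G.density μ ν W := by
  classical
  -- Choosing an incident edge for each vertex of a class is injective, so the truncated differences
  -- in the exponents are genuine.
  have hcard₁ : Fintype.card V₁ ≤ G.e := by
    choose σ hσ hσ' using hG.1
    rw [← Finset.card_univ]
    exact Finset.card_le_card_of_injOn σ (fun v _ => hσ v)
      (Function.LeftInverse.injective hσ').injOn
  have hcard₂ : Fintype.card V₂ ≤ G.e := by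
    choose σ hσ hσ' using hG.2
    rw [← Finset.card_univ]
    exact Finset.card_le_card_of_injOn σ (fun v _ => hσ v)
      (Function.LeftInverse.injective hσ').injOn
  obtain ⟨k₁, hk₁⟩ := Nat.exists_eq_add_of_le hcard₁
  obtain ⟨k₂, hk₂⟩ := Nat.exists_eq_add_of_le hcard₂
  -- The factors 2 come from keeping half of the density, the factors 4 from the degree bound. The
  -- constant depends on `G` alone, as tensor powers require.
  refine ⟨1 / (2 ^ Fintype.card V₁ * 2 ^ Fintype.card V₂ * (4 ^ k₁ * 4 ^ k₂)), by positivity, ?_⟩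
  intro X Y _ _ μ ν _ _ W hW hpos
  rw [rho_density W hW.measurable] at hpos ⊢
  obtain ⟨W', hW', hle, hdeg, hhalf⟩ := hW.exists_minDegree (μ := μ) (ν := ν)
  have hd'D : ∫ z, W' z ∂(μ.prod ν) ≤ ∫ z, W z ∂(μ.prod ν) :=
    integral_mono (hW'.integrable _) (hW.integrable _) hle
  set D := ∫ z, W z ∂(μ.prod ν)
  have hd : 0 < ∫ z, W' z ∂(μ.prod ν) := lt_of_lt_of_le (by positivity) hhalf
  have hδ : 0 < D / 4 := by positivity
  have h1 := isProbabilityMeasure_leftDegree hW' hd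
  have h2 := isProbabilityMeasure_rightDegree hW' hd
  have hR := isBigraphon_regularize hW' hδ hdeg
  have hrho := rho_density_regularize hW' hδ hdeg hd
  have hmain := hreg X Y _ _ _ hR (isBiregular_regularize hW' hδ hdeg hd) fun h => by
    rw [rho_density _ hR.measurable, integral_congr_ae h] at hrho
    simp at hrho
  rw [hrho, one_pow] at hmain
  have hmain := hmain.trans (density_regularize_le hG hW' hδ hdeg hd)
  have ht : G.density μ ν W' ≤ G.density μ ν W :=
    integral_mono (hW'.integrable_prod _ _) (hW.integrable_prod _ _) fun z =>
      Finset.prod_le_prod (fun _ _ => hW'.nonneg _) fun _ _ => hle _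
  have ht0 := hW'.density_nonneg (μ := μ) (ν := ν) G
  set d := ∫ z, W' z ∂(μ.prod ν)
  rw [Nat.sub_eq_of_eq_add' hk₁, Nat.sub_eq_of_eq_add' hk₂] at hmain
  -- Use d ≤ D in the numerator and d ≥ D / 2 in the denominator.
  have hC : d ^ G.e / (d ^ Fintype.card V₁ * d ^ Fintype.card V₂ *
      ((D / 4) ^ k₁ * (D / 4) ^ k₂)) ≤
      D ^ G.e / ((D / 2) ^ Fintype.card V₁ * (D / 2) ^ Fintype.card V₂ *
      ((D / 4) ^ k₁ * (D / 4) ^ k₂)) := by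
    gcongr
  have h3 : 1 ≤ D ^ G.e / ((D / 2) ^ Fintype.card V₁ * (D / 2) ^ Fintype.card V₂ *
      ((D / 4) ^ k₁ * (D / 4) ^ k₂)) * G.density μ ν W :=
    hmain.trans (mul_le_mul hC ht ht0 (by positivity))
  -- The powers of D in the denominator add up to 2 e(G); one half cancels the numerator and the
  -- other is the desired bound.
  have h4 : (D / 2) ^ Fintype.card V₁ * (D / 2) ^ Fintype.card V₂ *
      ((D / 4) ^ k₁ * (D / 4) ^ k₂) = D ^ G.e * (1 / (2 ^ Fintype.card V₁ *
        2 ^ Fintype.card V₂ * (4 ^ k₁ * 4 ^ k₂)) * D ^ G.e) := by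
    have : D ^ G.e * D ^ G.e = D ^ Fintype.card V₁ * D ^ Fintype.card V₂ * (D ^ k₁ * D ^ k₂) := by
      nth_rewrite 1 [hk₁]
      nth_rewrite 1 [hk₂]
      rw [pow_add, pow_add]
      ring
    simp only [div_pow]
    field_simp
    linarith
  rw [h4, div_mul_eq_mul_div, mul_div_mul_left _ _ (by positivity),
    le_div_iff₀ (by positivity), one_mul] at h3
  exact h3

end Regularization

/-! ### Tensor powers and the passage from biregular to arbitrary bigraphons. -/

section Tensor

variable {V₁ : Type u₁} {V₂ : Type u₂} [Fintype V₁] [Fintype V₂] {X Y : Type w}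
  [MeasurableSpace X] [MeasurableSpace Y]

/-- The tensor square of a bigraphon. -/
def tensorSquare (W : X × Y → ℝ) (z : (X × X) × (Y × Y)) : ℝ :=
  W (z.1.1, z.2.1) * W (z.1.2, z.2.2)

theorem isBigraphon_tensorSquare {W : X × Y → ℝ} (hW : IsBigraphon W) :
    IsBigraphon (tensorSquare W) := by
  obtain ⟨C, hC⟩ := hW.bounded
  refine ⟨?_, fun z => mul_nonneg (hW.nonneg _) (hW.nonneg _), C * C, fun z =>
    mul_le_mul (hC _) (hC _) (hW.nonneg _) ((hW.nonneg (z.1.1, z.2.1)).trans (hC _))⟩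
  exact (hW.measurable.comp (f := fun z : (X × X) × (Y × Y) => (z.1.1, z.2.1)) (by fun_prop)).mul
    (hW.measurable.comp (f := fun z : (X × X) × (Y × Y) => (z.1.2, z.2.2)) (by fun_prop))

/-- The two coordinates of a configuration in the squared spaces are independent, and the product
over the edges factors accordingly. -/
theorem density_tensorSquare {μ : Measure X} {ν : Measure Y} [IsProbabilityMeasure μ]
    [IsProbabilityMeasure ν] {W : X × Y → ℝ} (hW : IsBigraphon W) (G : Bigraph V₁ V₂) :
    G.density (μ.prod μ) (ν.prod ν) (tensorSquare W) = G.density μ ν W ^ 2 := by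
  let F : (V₁ → X) → (V₂ → Y) → ℝ := fun x y => ∏ p ∈ G.edges, W (x p.1, y p.2)
  have h1 := measurePreserving_arrowProdEquivProdArrow X X V₁ (fun _ => μ) fun _ => μ
  have h2 := measurePreserving_arrowProdEquivProdArrow Y Y V₂ (fun _ => ν) fun _ => ν
  have hF : ∀ x : V₁ → X × X, ∫ y : V₂ → Y × Y,
      ∏ p ∈ G.edges, tensorSquare W (x p.1, y p.2) ∂(Measure.pi fun _ => ν.prod ν) =
      (∫ y, F (fun v => (x v).1) y ∂(Measure.pi fun _ => ν)) *
        ∫ y, F (fun v => (x v).2) y ∂(Measure.pi fun _ => ν) := by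
    intro x
    rw [← integral_prod_mul, ← h2.integral_comp (MeasurableEquiv.measurableEmbedding _)]
    exact integral_congr_ae (Filter.Eventually.of_forall fun y => Finset.prod_mul_distrib)
  rw [Bigraph.density, integral_prod _ ((isBigraphon_tensorSquare hW).integrable_prod _ _)]
  simp only [hF]
  rw [Bigraph.density, integral_prod _ (hW.integrable_prod _ _), sq, ← integral_prod_mul,
    ← h1.integral_comp (MeasurableEquiv.measurableEmbedding _)]
  rfl

/-- A constant factor in Sidorenko's inequality can be removed by taking tensor powers. -/
theorem Bigraph.density_ge_of_const {G : Bigraph V₁ V₂} {c : ℝ} (hc : 0 < c)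
    (h : ∀ (X Y : Type w) [MeasurableSpace X] [MeasurableSpace Y] (μ : Measure X)
      (ν : Measure Y) [IsProbabilityMeasure μ] [IsProbabilityMeasure ν] (W : X × Y → ℝ),
      IsBigraphon W → 0 < rho.density μ ν W →
        c * rho.density μ ν W ^ G.e ≤ G.density μ ν W)
    (μ : Measure X) (ν : Measure Y) [IsProbabilityMeasure μ] [IsProbabilityMeasure ν]
    {W : X × Y → ℝ} (hW : IsBigraphon W) (hpos : 0 < rho.density μ ν W) :
    rho.density μ ν W ^ G.e ≤ G.density μ ν W := by
  -- The spaces are quantified inside, since the induction step applies the hypothesis to the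
  -- squared spaces. Repeated squaring yields the exponents 2 ^ n, which suffice.
  have key : ∀ (n : ℕ) (X Y : Type w) [MeasurableSpace X] [MeasurableSpace Y] (μ : Measure X)
      (ν : Measure Y) [IsProbabilityMeasure μ] [IsProbabilityMeasure ν] (W : X × Y → ℝ),
      IsBigraphon W → 0 < rho.density μ ν W →
        c * (rho.density μ ν W ^ G.e) ^ 2 ^ n ≤ G.density μ ν W ^ 2 ^ n := by
    intro n
    induction n with
    | zero => simpa using h
    | succ n ih =>
      intro X Y _ _ μ ν _ _ W hW hpos
      have h1 := ih (X × X) (Y × Y) (μ.prod μ) (ν.prod ν) (tensorSquare W)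
        (isBigraphon_tensorSquare hW) (by rw [density_tensorSquare hW]; positivity)
      rw [density_tensorSquare hW, density_tensorSquare hW] at h1
      rw [pow_right_comm _ 2 G.e] at h1
      rw [pow_succ' 2 n, pow_mul (rho.density μ ν W ^ G.e), pow_mul (G.density μ ν W)]
      exact h1
  by_contra! hlt
  set D := rho.density μ ν W ^ G.e with hD
  have hD0 : 0 < D := by positivity
  have ht0 := hW.density_nonneg (μ := μ) (ν := ν) G
  have hr0 : 0 ≤ G.density μ ν W / D := by positivity
  have hr1 : G.density μ ν W / D < 1 := (div_lt_one hD0).2 hlt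
  obtain ⟨n, hn⟩ := exists_pow_lt_of_lt_one hc hr1
  have h1 := key n X Y μ ν W hW hpos
  rw [← hD] at h1
  have h2 : c ≤ (G.density μ ν W / D) ^ 2 ^ n := by
    rw [div_pow, le_div_iff₀ (by positivity)]
    exact h1
  have h3 : (G.density μ ν W / D) ^ 2 ^ n ≤ (G.density μ ν W / D) ^ n :=
    pow_le_pow_of_le_one hr0 hr1.le (Nat.lt_two_pow_self).le
  linarith

omit [Fintype V₁] [Fintype V₂] in
theorem Bigraph.noIsolated_of_isConnected {G : Bigraph V₁ V₂} (hG : G.IsConnected)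
    [Nontrivial (V₁ ⊕ V₂)] : G.NoIsolated := by
  have hG' : G.graph.Preconnected := SimpleGraph.Connected.preconnected hG
  constructor
  · intro v
    obtain ⟨u, hu⟩ := hG'.exists_adj_of_nontrivial (Sum.inl v)
    rcases u with u | u
    · exact absurd hu (G.not_graph_adj_inl _ _)
    · exact ⟨_, (G.graph_adj_inl_inr _ _).1 hu, rfl⟩
  · intro v
    obtain ⟨u, hu⟩ := hG'.exists_adj_of_nontrivial (Sum.inr v)
    rcases u with u | u
    · exact ⟨_, (G.graph_adj_inr_inl _ _).1 hu, rfl⟩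
    · exact absurd hu (G.not_graph_adj_inr _ _)

/-- A bigraph without isolated vertices that satisfies Sidorenko's inequality for biregular
bigraphons is a Sidorenko bigraph. -/
theorem Bigraph.NoIsolated.isSidorenko {G : Bigraph V₁ V₂} (hG : G.NoIsolated) (he : G.e ≠ 0)
    (hreg : ∀ (X Y : Type w) [MeasurableSpace X] [MeasurableSpace Y] (μ : Measure X)
      (ν : Measure Y) [IsProbabilityMeasure μ] [IsProbabilityMeasure ν] (W : X × Y → ℝ),
      IsBigraphon W → IsBiregular μ ν W → ¬ W =ᵐ[μ.prod ν] 0 →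
        rho.density μ ν W ^ G.e ≤ G.density μ ν W) :
    Bigraph.IsSidorenko.{w, u₁, u₂} G := by
  intro X Y _ _ μ ν _ _ W hW
  obtain ⟨c, hc, h⟩ := hG.exists_const hreg
  -- At density 0 the bound is trivial only because 0 ^ e(G) = 0, which needs an edge.
  rcases (hW.density_nonneg (μ := μ) (ν := ν) rho).eq_or_lt with h0 | hpos
  · rw [← h0, zero_pow he]
    exact hW.density_nonneg G
  · exact Bigraph.density_ge_of_const hc h μ ν hW hpos

end Tensor

/-! ### The theorem. -/

theorem theorem3p5 {V₁ : Type u₁} {V₂ : Type u₂} [Fintype V₁] [Fintype V₂]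
    (G : Bigraph V₁ V₂) (hconn : G.IsConnected) (hnontriv : Nontrivial (V₁ ⊕ V₂))
    (T : ReflectiveTreeDecomposition G)
    {H₁ : Type u₃} {H₂ : Type u₄} [Fintype H₁] [Fintype H₂]
    (H : Bigraph H₁ H₂) (hcore : T.IsCore H)
    (hdom : ∀ U₁ U₂ : T.bags, T.tree.Adj U₁ U₂ →
      Bigraph.WeaklyDominates.{w, u₃, u₄, u₁, u₂} H (G.induce (U₁.1 ∩ U₂.1))) :
    Bigraph.WeaklyDominates.{w, u₁, u₂, u₃, u₄} G H ∧
      (Bigraph.IsSidorenko.{w, u₃, u₄} H → Bigraph.IsSidorenko.{w, u₁, u₂} G) := by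
  have hGH : Bigraph.WeaklyDominates.{w, u₁, u₂, u₃, u₄} G H := T.weaklyDominates hcore hdom
  refine ⟨hGH, fun hH => ?_⟩
  have hG := Bigraph.noIsolated_of_isConnected hconn
  refine hG.isSidorenko ?_ fun X Y _ _ μ ν _ _ W hW hb h0 => ?_
  · obtain ⟨p, hp⟩ : ∃ p, p ∈ G.edges := by
      obtain ⟨v | v, -⟩ := exists_pair_ne (V₁ ⊕ V₂)
      · exact (hG.1 v).imp fun _ h => h.1
      · exact (hG.2 v).imp fun _ h => h.1
    exact Finset.card_ne_zero_of_mem hp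
  · have hpos := hW.rho_density_pos h0
    have h1 := hGH X Y μ ν W hW hb h0
    have h2 : 1 ≤ H.density μ ν W / Bigraph.rho.density μ ν W ^ H.e := by
      rw [le_div_iff₀ (by positivity), one_mul]
      exact hH X Y μ ν W hW
    have h3 := h2.trans h1
    rwa [le_div_iff₀ (by positivity), one_mul] at h3
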